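/- Let $p:E\to M$ be a locally trivial smooth fiber bundle (smooth manifolds are finite dimensional and without boundary) whose standard fiber $F$ has the same dimension $n$ as $M$. Let $\alpha=(\alpha_1,\dots,\alpha_n):TM\to\mathbb R^n=:V$ be a smooth global coframe field on $M$, that is, $\alpha_x:T_xM\to V$ is a linear isomorphism for every $x\in M$, and let $f=(f_1,\dots,f_n):E\to V^*$ be a smooth function. Consider the 1-form $$\Theta_f:=\langle f,p^*\alpha\rangle=\sum_i f_i\,p^*\alpha_i\in\Omega^1(E),\qquad \omega_f:=d\Theta_f.$$ (a) $\omega_f$ is a symplectic form on $E$ (smooth, closed, nondegenerate) if and only if for every $x\in M$ the restriction $f|_{E_x}:E_x\to V^*$ to the fiber $E_x=p^{-1}(x)$ is a local diffeomorphism. (b) In this case $\Theta_f$ is a Liouville form for $(E,\omega_f)$: it is horizontal, i.e. $\Theta_f(Y)=0$ for all $Y\in\ker Tp$; one has $\omega_f=d\Theta_f$; and the fibers of $p$ are Lagrangian submanifolds of $(E,\omega_f)$. (c) In this case let $X_1,\dots,X_n$ be the frame field of $TM$ dual to $\alpha$, with torsion functions $c^i_{jk}\in C^\infty(M,\mathbb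 R)$ given by $[X_j,X_k]=\sum_i c^i_{jk}X_i$. Each $X_j$ has a unique Liouville lift, i.e. a unique smooth vector field $X_j^{\Theta}$ on $E$ with $Tp\circ X_j^{\Theta}=X_j\circ p$ and $\mathcal L_{X_j^{\Theta}}\Theta_f=0$. The vector fields $Z_j:=\omega_f^{-1}p^*\alpha_j$, determined by $i_{Z_j}\omega_f=p^*\alpha_j$, are smooth. The Poisson bivector field $\Lambda_f=\omega_f^{-1}$, i.e. the bivector field with $\Lambda_f(a,b)=b(v)$ for $a,b\in T^*_uE$, where $v\in T_uE$ is the vector with $i_v\omega_f=a$, is given by $$\Lambda_f=\sum_j X_j^{\Theta}\wedge Z_j+\frac12\sum_{i,j,k}f_i\,(c^i_{jk}\circ p)\,Z_j\wedge Z_k ,$$ where $v\wedge w=v\otimes w-w\otimes v$, i.e. $(v\wedge w)(a,b)=a(v)b(w)-a(w)b(v)$. -/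

import Mathlib

open Bundle Set
open scoped Manifold ContDiff

noncomputable section

namespace LiouvilleBundle

section Forms

variable {H : Type*} [NormedAddCommGroup H] [NormedSpace ℝ H]
  {N : Type*} [TopologicalSpace N] [ChartedSpace H N]

/-- A (not necessarily smooth) field of real alternating `k`-forms on the manifold `N`, which is
modelled on the normed space `H` and has no boundary. -/
abbrev FormField (H : Type*) [NormedAddCommGroup H] [NormedSpace ℝ H]
    (N : Type*) [TopologicalSpace N] [ChartedSpace H N] (k : ℕ) : Type _ :=
  (u : N) → (TangentSpace 𝓘(ℝ, H) u) [⋀^Fin k]→L[ℝ] ℝ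

/-- A (not necessarily smooth) vector field on `N`. -/
abbrev VField (H : Type*) [NormedAddCommGroup H] [NormedSpace ℝ H]
    (N : Type*) [TopologicalSpace N] [ChartedSpace H N] : Type _ :=
  (u : N) → TangentSpace 𝓘(ℝ, H) u

/-- The local representative of `σ` in the preferred chart at `u`: the pullback of `σ` by the
inverse of that chart. -/
def formInChart {k : ℕ} (σ : FormField H N k) (u : N) (y : H) : H [⋀^Fin k]→L[ℝ] ℝ :=
  (σ ((extChartAt 𝓘(ℝ, H) u).symm y)).compContinuousLinearMap
    (mfderiv 𝓘(ℝ, H) 𝓘(ℝ, H) (extChartAt 𝓘(ℝ, H) u).symm y)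

/-- The local representative of the vector field `Y` in the preferred chart at `u`. -/
def fieldInChart (Y : VField H N) (u : N) (y : H) : H :=
  mfderiv 𝓘(ℝ, H) 𝓘(ℝ, H) (extChartAt 𝓘(ℝ, H) u) ((extChartAt 𝓘(ℝ, H) u).symm y)
    (Y ((extChartAt 𝓘(ℝ, H) u).symm y))

/-- `σ` is a smooth differential `k`-form: its coefficients in charts are smooth. -/
def IsSmoothForm {k : ℕ} (σ : FormField H N k) : Prop :=
  ∀ u : N, ContDiffOn ℝ ∞ (formInChart σ u) (extChartAt 𝓘(ℝ, H) u).target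

/-- `Y` is a smooth vector field, that is, a smooth section of the tangent bundle. -/
def IsSmoothField [IsManifold 𝓘(ℝ, H) ∞ N] (Y : VField H N) : Prop :=
  ContMDiff 𝓘(ℝ, H) 𝓘(ℝ, H).tangent ∞ (fun u : N => (⟨u, Y u⟩ : TangentBundle 𝓘(ℝ, H) N))

/-- The exterior derivative, computed at `u` in the preferred chart at `u`. -/
def extd {k : ℕ} (σ : FormField H N k) : FormField H N (k + 1) := fun u =>
  (extDeriv (formInChart σ u) (extChartAt 𝓘(ℝ, H) u u)).compContinuousLinearMap
    (mfderiv 𝓘(ℝ, H) 𝓘(ℝ, H) (extChartAt 𝓘(ℝ, H) u) u)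

/-- The Lie derivative of a `k`-form along `Y`, in coordinates:
`(L_Y σ)(v₁, …, v_k) = (∂_Y σ)(v₁, …, v_k) + ∑ᵢ σ(v₁, …, ∂_{vᵢ} Y, …, v_k)`. -/
def lieD {k : ℕ} (Y : VField H N) (σ : FormField H N k) (u : N)
    (v : Fin k → TangentSpace 𝓘(ℝ, H) u) : ℝ :=
  let y : H := extChartAt 𝓘(ℝ, H) u u
  let w : Fin k → H := fun i => mfderiv 𝓘(ℝ, H) 𝓘(ℝ, H) (extChartAt 𝓘(ℝ, H) u) u (v i)
  fderiv ℝ (formInChart σ u) y (fieldInChart Y u y) w +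
    ∑ i, formInChart σ u y (Function.update w i (fderiv ℝ (fieldInChart Y u) y (w i)))

/-- A real linear form on each tangent space, as a field of alternating `1`-forms. -/
def oneForm (θ : (u : N) → TangentSpace 𝓘(ℝ, H) u →L[ℝ] ℝ) : FormField H N 1 := fun u =>
  ContinuousAlternatingMap.ofSubsingleton ℝ (TangentSpace 𝓘(ℝ, H) u) ℝ (0 : Fin 1) (θ u)

/-- A symplectic form: a smooth, closed, pointwise nondegenerate `2`-form. -/
structure IsSymplectic (σ : FormField H N 2) : Prop where
  smooth : IsSmoothForm σ
  closed : extd σ = 0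
  nondegenerate : ∀ (u : N) (v : TangentSpace 𝓘(ℝ, H) u),
    (∀ w : TangentSpace 𝓘(ℝ, H) u, σ u ![v, w] = 0) → v = 0

/-- The contraction `i_v σ = σ(v, ·)` of a `2`-form with a tangent vector. -/
def flat (σ : FormField H N 2) (u : N) (v : TangentSpace 𝓘(ℝ, H) u) :
    TangentSpace 𝓘(ℝ, H) u →L[ℝ] ℝ :=
  (σ u).toContinuousLinearMap ![v, 0] 1

/-- The inverse `σ⁻¹ : T^*N → TN` of `v ↦ i_v σ` (meaningful where `σ` is nondegenerate). -/
def sharp (σ : FormField H N 2) (u : N) (a : TangentSpace 𝓘(ℝ, H) u →L[ℝ] ℝ) :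
    TangentSpace 𝓘(ℝ, H) u :=
  Function.invFun (flat σ u) a

/-- The bivector field `Λ = σ⁻¹`, as a form on covectors: contracting `Λ` with the covector `a` in
the first slot gives the tangent vector `σ⁻¹ a`, that is, `Λ(a, b) = b(σ⁻¹ a)`. -/
def poissonBivector (σ : FormField H N 2) (u : N) (a b : TangentSpace 𝓘(ℝ, H) u →L[ℝ] ℝ) : ℝ :=
  b (sharp σ u a)

/-- The bivector `v ∧ w = v ⊗ w - w ⊗ v`, as a form on covectors. -/
def wedge {u : N} (v w : TangentSpace 𝓘(ℝ, H) u) (a b : TangentSpace 𝓘(ℝ, H) u →L[ℝ] ℝ) : ℝ :=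
  a v * b w - a w * b v

end Forms

section Bundles

variable {EM : Type*} [NormedAddCommGroup EM] [NormedSpace ℝ EM]
  {EF : Type*} [NormedAddCommGroup EF] [NormedSpace ℝ EF]
  {EE : Type*} [NormedAddCommGroup EE] [NormedSpace ℝ EE]
  {M : Type*} [TopologicalSpace M] [ChartedSpace EM M]
  {F : Type*} [TopologicalSpace F] [ChartedSpace EF F]
  {E : Type*} [TopologicalSpace E] [ChartedSpace EE E]

/-- A local trivialization `p⁻¹(U) ≃ U × F` that is a diffeomorphism. -/
structure IsSmoothTrivialization (EM EF EE : Type*)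
    [NormedAddCommGroup EM] [NormedSpace ℝ EM] [NormedAddCommGroup EF] [NormedSpace ℝ EF]
    [NormedAddCommGroup EE] [NormedSpace ℝ EE] [ChartedSpace EM M] [ChartedSpace EF F]
    [ChartedSpace EE E] {p : E → M} (e : Trivialization F p) : Prop where
  contMDiffOn : ContMDiffOn 𝓘(ℝ, EE) (𝓘(ℝ, EM).prod 𝓘(ℝ, EF)) ∞ e.toOpenPartialHomeomorph e.source
  contMDiffOn_symm : ContMDiffOn (𝓘(ℝ, EM).prod 𝓘(ℝ, EF)) 𝓘(ℝ, EE) ∞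
    e.toOpenPartialHomeomorph.symm e.target

/-- `p : E → M` is a locally trivial smooth fiber bundle with standard fiber `F`. -/
structure IsSmoothFiberBundle (EM EF EE : Type*)
    [NormedAddCommGroup EM] [NormedSpace ℝ EM] [NormedAddCommGroup EF] [NormedSpace ℝ EF]
    [NormedAddCommGroup EE] [NormedSpace ℝ EE] [ChartedSpace EM M]
    (F : Type*) [TopologicalSpace F] [ChartedSpace EF F]
    [ChartedSpace EE E] (p : E → M) : Prop where
  contMDiff : ContMDiff 𝓘(ℝ, EE) 𝓘(ℝ, EM) ∞ p
  locallyTrivial : ∀ x : M, ∃ e : Trivialization F p,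
    x ∈ e.baseSet ∧ IsSmoothTrivialization EM EF EE e

/-- The restriction of `f` to every fiber `E_x = p⁻¹(x)` is a local diffeomorphism into `W`. The
smooth structure of the submanifold `E_x` of `E` is the one for which the diffeomorphisms
`F ≃ E_x`, `y ↦ e⁻¹(x, y)`, given by the smooth local trivializations `e`, are
diffeomorphisms. -/
def IsFiberwiseLocalDiffeo (EM EF EE : Type*)
    [NormedAddCommGroup EM] [NormedSpace ℝ EM] [NormedAddCommGroup EF] [NormedSpace ℝ EF]
    [NormedAddCommGroup EE] [NormedSpace ℝ EE] [ChartedSpace EM M]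
    (F : Type*) [TopologicalSpace F] [ChartedSpace EF F]
    [ChartedSpace EE E] (p : E → M)
    {W : Type*} [NormedAddCommGroup W] [NormedSpace ℝ W] (f : E → W) : Prop :=
  ∀ x : M, ∀ e : Trivialization F p, x ∈ e.baseSet → IsSmoothTrivialization EM EF EE e →
    IsLocalDiffeomorph 𝓘(ℝ, EF) 𝓘(ℝ, W) ∞
      (fun y : F => f (e.toOpenPartialHomeomorph.symm (x, y)))

/-- The tangent map `T_u p`. -/
def tangentProj (EM EE : Type*) [NormedAddCommGroup EM] [NormedSpace ℝ EM]
    [NormedAddCommGroup EE] [NormedSpace ℝ EE] [ChartedSpace EM M] [ChartedSpace EE E]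
    (p : E → M) (u : E) : TangentSpace 𝓘(ℝ, EE) u →L[ℝ] TangentSpace 𝓘(ℝ, EM) (p u) :=
  mfderiv 𝓘(ℝ, EE) 𝓘(ℝ, EM) p u

/-- `Θ` is a Liouville form for the symplectic manifold `(E, σ)` fibered by `p : E → M`: it is a
smooth horizontal `1`-form with `dΘ = σ`, and the fibers of `p` are Lagrangian, that is, the
vertical space `ker T_u p` is its own `σ`-orthogonal complement at every point `u`. -/
structure IsLiouvilleForm (EM : Type*) [NormedAddCommGroup EM] [NormedSpace ℝ EM]
    [ChartedSpace EM M] (p : E → M) (σ : FormField EE E 2) (Θ : FormField EE E 1) : Prop where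
  symplectic : IsSymplectic σ
  smooth : IsSmoothForm Θ
  horizontal : ∀ (u : E) (v : TangentSpace 𝓘(ℝ, EE) u), tangentProj EM EE p u v = 0 → Θ u ![v] = 0
  extd_eq : σ = extd Θ
  lagrangian : ∀ (u : E) (v : TangentSpace 𝓘(ℝ, EE) u),
    tangentProj EM EE p u v = 0 ↔
      ∀ w : TangentSpace 𝓘(ℝ, EE) u, tangentProj EM EE p u w = 0 → σ u ![v, w] = 0

/-- `Y` is a Liouville lift to `E` of the vector field `X` on `M`: a smooth vector field that is
projectable onto `X` and satisfies `L_Y Θ = 0`. -/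
structure IsLiouvilleLift [IsManifold 𝓘(ℝ, EE) ∞ E] (p : E → M) (Θ : FormField EE E 1)
    (X : VField EM M) (Y : VField EE E) : Prop where
  smooth : IsSmoothField Y
  projectable : ∀ u : E, tangentProj EM EE p u (Y u) = X (p u)
  lie_eq_zero : ∀ (u : E) (v : TangentSpace 𝓘(ℝ, EE) u), lieD Y Θ u ![v] = 0

variable {n : ℕ}

/-- A smooth coframe field `α = (α₁, …, αₙ) : TM → ℝⁿ`. -/
structure IsCoframe [IsManifold 𝓘(ℝ, EM) ∞ M]
    (α : (x : M) → TangentSpace 𝓘(ℝ, EM) x →L[ℝ] (Fin n → ℝ)) : Prop where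
  smooth : ContMDiff 𝓘(ℝ, EM).tangent 𝓘(ℝ, Fin n → ℝ) ∞
    (fun v : TangentBundle 𝓘(ℝ, EM) M => α v.1 v.2)
  bijective : ∀ x : M, Function.Bijective (α x)

/-- The frame `X₁, …, Xₙ` dual to the coframe `α`: `α_i(X_j) = δ_{ij}`. -/
def dualFrame (α : (x : M) → TangentSpace 𝓘(ℝ, EM) x →L[ℝ] (Fin n → ℝ)) (j : Fin n) : VField EM M :=
  fun x => (α x).inverse (Pi.single j 1)

/-- The torsion functions `c^i_{jk}` of the frame: `[X_j, X_k] = ∑ᵢ c^i_{jk} X_i`. -/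
def torsion (α : (x : M) → TangentSpace 𝓘(ℝ, EM) x →L[ℝ] (Fin n → ℝ)) (i j k : Fin n) (x : M) : ℝ :=
  α x (VectorField.mlieBracket 𝓘(ℝ, EM) (dualFrame α j) (dualFrame α k) x) i

/-- The pulled back form `p^* α_j` on `E`. -/
def pullCoframe (EE : Type*) [NormedAddCommGroup EE] [NormedSpace ℝ EE] [ChartedSpace EE E]
    (p : E → M) (α : (x : M) → TangentSpace 𝓘(ℝ, EM) x →L[ℝ] (Fin n → ℝ)) (j : Fin n) (u : E) :
    TangentSpace 𝓘(ℝ, EE) u →L[ℝ] ℝ :=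
  (ContinuousLinearMap.proj j).comp ((α (p u)).comp (tangentProj EM EE p u))

/-- The `1`-form `Θ_f = ⟨f, p^* α⟩` on `E`, for `f : E → V^*` with `V = ℝⁿ`. -/
def thetaForm (EE : Type*) [NormedAddCommGroup EE] [NormedSpace ℝ EE] [ChartedSpace EE E]
    (p : E → M) (α : (x : M) → TangentSpace 𝓘(ℝ, EM) x →L[ℝ] (Fin n → ℝ))
    (f : E → StrongDual ℝ (Fin n → ℝ)) : FormField EE E 1 :=
  oneForm fun u => (f u).comp ((α (p u)).comp (tangentProj EM EE p u))

end Bundles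

end LiouvilleBundle

end

/-! At a point `u` of `E` put A = α ∘ T_u p and D = T_u f. The product rule, the naturality of d
under pullback by `p`, and the structure equation dα_i(X_j, X_k) = -c^i_{jk} give ω(v, w) = D v (A
w) - D w (A v) - ∑ f_i c^i_{jk} (A v)_j (A w)_k, which is `extd_thetaForm`. The rest is mostly
linear algebra for bilinear forms of this shape (`IsTwistedWedge`). The vertical space is ker A
because α is an isomorphism, and on a vertical v the form reduces to ω(v, w) = D v (A w).

Hence a vertical vector killed by D lies in the radical of ω. Conversely, if D is injective on ker
A, it is bijective from ker A onto V^*, since both have dimension n. Pairing a radical vector with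
all vertical vectors then shows that it is vertical, and surjectivity of A shows that D kills it. So
nondegeneracy means that D is injective on vertical vectors everywhere; by the inverse function
theorem this says that f is a local diffeomorphism on fibers. The same pairing shows that the fibers
are Lagrangian.

If Y projects to X_j, then Θ(Y) = f_j, so Cartan's formula turns L_Y Θ = 0 into i_Y ω = -df_j. This
determines Y; the field so defined does project to X_j, again by pairing with vertical vectors. For
the bivector, write covectors as a = i_v ω and b = i_w ω. Then Λ(a, b) = ω(w, v), the values of a
and b on the lifts and on Z_j are components of D and A, and the formula becomes the displayed
expression for ω (`IsTwistedWedge.inverse_formula`). -/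

noncomputable section

namespace LiouvilleBundle

/-! ### Differential forms and vector fields under changes of chart -/

section Charts

variable {H : Type*} [NormedAddCommGroup H] [NormedSpace ℝ H]
  {N : Type*} [TopologicalSpace N] [ChartedSpace H N]

/-- The change of coordinates from the chart at `u₀` to the chart at `u`. -/
def chartChange (u₀ u : N) (y : H) : H :=
  extChartAt 𝓘(ℝ, H) u ((extChartAt 𝓘(ℝ, H) u₀).symm y)

theorem symm_chartChange {u₀ u : N} {y : H}
    (hu : (extChartAt 𝓘(ℝ, H) u₀).symm y ∈ (extChartAt 𝓘(ℝ, H) u).source) :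
    (extChartAt 𝓘(ℝ, H) u).symm (chartChange u₀ u y) = (extChartAt 𝓘(ℝ, H) u₀).symm y :=
  (extChartAt 𝓘(ℝ, H) u).left_inv hu

theorem formInChart_apply {k : ℕ} (σ : FormField H N k) (u : N) (y : H) (v : Fin k → H) :
    formInChart σ u y v = σ ((extChartAt 𝓘(ℝ, H) u).symm y)
      (fun i => mfderiv 𝓘(ℝ, H) 𝓘(ℝ, H) (extChartAt 𝓘(ℝ, H) u).symm y (v i)) := rfl

theorem minSmoothness_real_two_le : minSmoothness ℝ 2 ≤ (∞ : WithTop ℕ∞) := by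
  rw [minSmoothness_of_isRCLikeNormedField]
  exact WithTop.coe_le_coe.2 le_top

theorem contDiffOn_extDeriv {k : ℕ} {s : Set H} (hs : IsOpen s) {η : H → H [⋀^Fin k]→L[ℝ] ℝ}
    (hη : ContDiffOn ℝ ∞ η s) : ContDiffOn ℝ ∞ (extDeriv η) s :=
  (ContinuousAlternatingMap.alternatizeUncurryFinCLM ℝ H ℝ).contDiff.comp_contDiffOn
    (hη.fderiv_of_isOpen hs (by simp))

theorem extDeriv_one_apply {η : H → H [⋀^Fin 1]→L[ℝ] ℝ} {y : H} (v w : H) :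
    extDeriv η y ![v, w] = fderiv ℝ η y v ![w] - fderiv ℝ η y w ![v] := by
  have h0 : Fin.removeNth (0 : Fin 2) ![v, w] = ![w] := by ext i; fin_cases i; rfl
  have h1 : Fin.removeNth (1 : Fin 2) ![v, w] = ![v] := by ext i; fin_cases i; rfl
  simp [extDeriv, ContinuousAlternatingMap.alternatizeUncurryFin_apply, Fin.sum_univ_two, h0, h1,
    sub_eq_add_neg]

variable [IsManifold 𝓘(ℝ, H) ∞ N]

theorem mdifferentiableAt_chart_symm {u : N} {y : H} (hy : y ∈ (extChartAt 𝓘(ℝ, H) u).target) :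
    MDifferentiableAt 𝓘(ℝ, H) 𝓘(ℝ, H) (extChartAt 𝓘(ℝ, H) u).symm y := by
  have h := (contMDiffOn_extChartAt_symm (I := 𝓘(ℝ, H)) (n := ∞) u).contMDiffAt
    ((isOpen_extChartAt_target u).mem_nhds hy)
  exact h.mdifferentiableAt (by simp)

theorem mdifferentiableAt_chart {u w : N} (hw : w ∈ (extChartAt 𝓘(ℝ, H) u).source) :
    MDifferentiableAt 𝓘(ℝ, H) 𝓘(ℝ, H) (extChartAt 𝓘(ℝ, H) u) w :=
  mdifferentiableAt_extChartAt (by rwa [extChartAt_source] at hw)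

theorem mfderiv_chart_mfderiv_symm {u : N} {y : H} (hy : y ∈ (extChartAt 𝓘(ℝ, H) u).target)
    (v : H) :
    mfderiv 𝓘(ℝ, H) 𝓘(ℝ, H) (extChartAt 𝓘(ℝ, H) u) ((extChartAt 𝓘(ℝ, H) u).symm y)
      (mfderiv 𝓘(ℝ, H) 𝓘(ℝ, H) (extChartAt 𝓘(ℝ, H) u).symm y v) = v := by
  have h := mfderiv_extChartAt_comp_mfderivWithin_extChartAt_symm hy
  rw [modelWithCornersSelf_coe, range_id, mfderivWithin_univ] at h
  exact DFunLike.congr_fun h v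

theorem mfderiv_symm_mfderiv_chart {u : N} {y : H} (hy : y ∈ (extChartAt 𝓘(ℝ, H) u).target)
    (v : TangentSpace 𝓘(ℝ, H) ((extChartAt 𝓘(ℝ, H) u).symm y)) :
    mfderiv 𝓘(ℝ, H) 𝓘(ℝ, H) (extChartAt 𝓘(ℝ, H) u).symm y
      (mfderiv 𝓘(ℝ, H) 𝓘(ℝ, H) (extChartAt 𝓘(ℝ, H) u) ((extChartAt 𝓘(ℝ, H) u).symm y) v) = v := by
  have h := mfderivWithin_extChartAt_symm_comp_mfderiv_extChartAt hy
  rw [modelWithCornersSelf_coe, range_id, mfderivWithin_univ] at h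
  exact DFunLike.congr_fun h v

theorem mfderiv_chart_self (u : N) (v : TangentSpace 𝓘(ℝ, H) u) :
    mfderiv 𝓘(ℝ, H) 𝓘(ℝ, H) (extChartAt 𝓘(ℝ, H) u) u v = v := by
  rw [mfderiv_extChartAt_self]; rfl

theorem mfderiv_chart_symm_self (u : N) (v : H) :
    mfderiv 𝓘(ℝ, H) 𝓘(ℝ, H) (extChartAt 𝓘(ℝ, H) u).symm (extChartAt 𝓘(ℝ, H) u u) v = v := by
  have h := mfderivWithin_range_extChartAt_symm (I := 𝓘(ℝ, H)) (x := u)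
  rw [modelWithCornersSelf_coe, range_id, mfderivWithin_univ] at h
  exact DFunLike.congr_fun h v

theorem contDiffAt_chartChange {u₀ u : N} {y : H} (hy : y ∈ (extChartAt 𝓘(ℝ, H) u₀).target)
    (hu : (extChartAt 𝓘(ℝ, H) u₀).symm y ∈ (extChartAt 𝓘(ℝ, H) u).source) :
    ContDiffAt ℝ ∞ (chartChange u₀ u) y := by
  rw [← contMDiffAt_iff_contDiffAt]
  have h1 := (contMDiffOn_extChartAt_symm (I := 𝓘(ℝ, H)) (n := ∞) u₀).contMDiffAt
    ((isOpen_extChartAt_target u₀).mem_nhds hy)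
  have h2 : ContMDiffAt 𝓘(ℝ, H) 𝓘(ℝ, H) ∞ (extChartAt 𝓘(ℝ, H) u)
      ((extChartAt 𝓘(ℝ, H) u₀).symm y) :=
    contMDiffAt_extChartAt' (by rwa [extChartAt_source] at hu)
  exact h2.comp y h1

theorem eventually_mem_chart {u₀ u : N} {y : H} (hy : y ∈ (extChartAt 𝓘(ℝ, H) u₀).target)
    (hu : (extChartAt 𝓘(ℝ, H) u₀).symm y ∈ (extChartAt 𝓘(ℝ, H) u).source) :
    ∀ᶠ z in nhds y, z ∈ (extChartAt 𝓘(ℝ, H) u₀).target ∧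
      (extChartAt 𝓘(ℝ, H) u₀).symm z ∈ (extChartAt 𝓘(ℝ, H) u).source := by
  refine Filter.Eventually.and ((isOpen_extChartAt_target u₀).mem_nhds hy) ?_
  have h1 := (contMDiffOn_extChartAt_symm (I := 𝓘(ℝ, H)) (n := ∞) u₀).contMDiffAt
    ((isOpen_extChartAt_target u₀).mem_nhds hy)
  exact h1.continuousAt ((isOpen_extChartAt_source u).mem_nhds hu)

theorem fderiv_chartChange {u₀ u : N} {y : H} (hy : y ∈ (extChartAt 𝓘(ℝ, H) u₀).target)
    (hu : (extChartAt 𝓘(ℝ, H) u₀).symm y ∈ (extChartAt 𝓘(ℝ, H) u).source) (v : H) :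
    fderiv ℝ (chartChange u₀ u) y v =
      mfderiv 𝓘(ℝ, H) 𝓘(ℝ, H) (extChartAt 𝓘(ℝ, H) u) ((extChartAt 𝓘(ℝ, H) u₀).symm y)
        (mfderiv 𝓘(ℝ, H) 𝓘(ℝ, H) (extChartAt 𝓘(ℝ, H) u₀).symm y v) := by
  rw [← mfderiv_eq_fderiv]
  have h := mfderiv_comp y (mdifferentiableAt_chart hu) (mdifferentiableAt_chart_symm hy)
  exact DFunLike.congr_fun h v

theorem mfderiv_symm_chartChange {u₀ u : N} {y : H} (hy : y ∈ (extChartAt 𝓘(ℝ, H) u₀).target)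
    (hu : (extChartAt 𝓘(ℝ, H) u₀).symm y ∈ (extChartAt 𝓘(ℝ, H) u).source) (v : H) :
    (mfderiv 𝓘(ℝ, H) 𝓘(ℝ, H) (extChartAt 𝓘(ℝ, H) u).symm (chartChange u₀ u y)
      (fderiv ℝ (chartChange u₀ u) y v) : H) =
      mfderiv 𝓘(ℝ, H) 𝓘(ℝ, H) (extChartAt 𝓘(ℝ, H) u₀).symm y v := by
  have hm : chartChange u₀ u y ∈ (extChartAt 𝓘(ℝ, H) u).target :=
    (extChartAt 𝓘(ℝ, H) u).map_source hu
  rw [← mfderiv_eq_fderiv]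
  have h := mfderiv_comp y (mdifferentiableAt_chart_symm hm)
    ((contDiffAt_chartChange hy hu).contMDiffAt.mdifferentiableAt (by simp))
  have h' : mfderiv 𝓘(ℝ, H) 𝓘(ℝ, H) ((extChartAt 𝓘(ℝ, H) u).symm ∘ chartChange u₀ u) y =
      mfderiv 𝓘(ℝ, H) 𝓘(ℝ, H) (extChartAt 𝓘(ℝ, H) u₀).symm y := by
    apply Filter.EventuallyEq.mfderiv_eq
    filter_upwards [eventually_mem_chart hy hu] with z hz
    exact symm_chartChange hz.2
  rw [h'] at h
  exact (DFunLike.congr_fun h v).symm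

theorem fieldInChart_self (Y : VField H N) (u : N) :
    fieldInChart Y u (extChartAt 𝓘(ℝ, H) u u) = Y u := by
  unfold fieldInChart
  -- The point obtained by applying the chart and then its inverse equals `u` only propositionally,
  -- while the tangent space depends on it. The claim is therefore stated for a variable `w` before
  -- substitution.
  have : ∀ w : N, w = u →
    (mfderiv 𝓘(ℝ, H) 𝓘(ℝ, H) (extChartAt 𝓘(ℝ, H) u) w (Y w) : H) = Y u := by
    rintro w rfl; exact mfderiv_chart_self _ _
  exact this _ (extChartAt_to_inv u)

theorem extd_apply {k : ℕ} (σ : FormField H N k) (u : N)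
    (v : Fin (k + 1) → TangentSpace 𝓘(ℝ, H) u) :
    extd σ u v = extDeriv (formInChart σ u) (extChartAt 𝓘(ℝ, H) u u) v := by
  unfold extd
  rw [mfderiv_extChartAt_self]
  rfl

theorem formInChart_chartChange {k : ℕ} (σ : FormField H N k) {u₀ u : N} {y : H}
    (hy : y ∈ (extChartAt 𝓘(ℝ, H) u₀).target)
    (hu : (extChartAt 𝓘(ℝ, H) u₀).symm y ∈ (extChartAt 𝓘(ℝ, H) u).source) :
    formInChart σ u₀ y = (formInChart σ u (chartChange u₀ u y)).compContinuousLinearMap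
      (fderiv ℝ (chartChange u₀ u) y) := by
  ext v
  rw [ContinuousAlternatingMap.compContinuousLinearMap_apply, formInChart_apply, formInChart_apply]
  simp only [Function.comp_apply, mfderiv_symm_chartChange hy hu]
  have : ∀ w w' : N, w = w' → ∀ a : Fin k → H,
    (σ w : (Fin k → H) → ℝ) a = (σ w' : (Fin k → H) → ℝ) a := by rintro w _ rfl; simp
  exact this _ _ (symm_chartChange hu).symm _

/-- `extd` uses a different chart at each point. Since the exterior derivative commutes with
pullback along chart changes, one fixed chart computes it on its whole target. Smoothness of dσ and
d² = 0 both rest on this. -/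
theorem formInChart_extd {k : ℕ} {σ : FormField H N k} (hσ : IsSmoothForm σ) (u₀ : N) {y : H}
    (hy : y ∈ (extChartAt 𝓘(ℝ, H) u₀).target) :
    formInChart (extd σ) u₀ y = extDeriv (formInChart σ u₀) y := by
  set u := (extChartAt 𝓘(ℝ, H) u₀).symm y with hu
  have hm : (extChartAt 𝓘(ℝ, H) u₀).symm y ∈ (extChartAt 𝓘(ℝ, H) u).source :=
    mem_extChartAt_source u
  have hev : formInChart σ u₀ =ᶠ[nhds y] fun z =>
      (formInChart σ u (chartChange u₀ u z)).compContinuousLinearMap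
        (fderiv ℝ (chartChange u₀ u) z) := by
    filter_upwards [eventually_mem_chart hy hm] with z hz
    exact formInChart_chartChange σ hz.1 hz.2
  have hd : DifferentiableAt ℝ (formInChart σ u) (chartChange u₀ u y) :=
    ((hσ u).contDiffAt ((isOpen_extChartAt_target u).mem_nhds
      ((extChartAt 𝓘(ℝ, H) u).map_source hm))).differentiableAt (by simp)
  rw [hev.extDeriv_eq, extDeriv_pullback hd (contDiffAt_chartChange hy hm)
    minSmoothness_real_two_le]
  ext v
  rw [formInChart_apply, extd_apply, ContinuousAlternatingMap.compContinuousLinearMap_apply]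
  have : (fun i => mfderiv 𝓘(ℝ, H) 𝓘(ℝ, H) (extChartAt 𝓘(ℝ, H) u₀).symm y (v i)) =
    fderiv ℝ (chartChange u₀ u) y ∘ v := by
    funext i
    rw [Function.comp_apply, fderiv_chartChange hy hm]
    exact (mfderiv_chart_self u _).symm
  rw [this]
  rfl

theorem IsSmoothForm.extd {k : ℕ} {σ : FormField H N k} (hσ : IsSmoothForm σ) :
    IsSmoothForm (extd σ) := fun u =>
  (contDiffOn_extDeriv (isOpen_extChartAt_target u) (hσ u)).congr
    fun _ hy => formInChart_extd hσ u hy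

theorem extd_extd {k : ℕ} {σ : FormField H N k} (hσ : IsSmoothForm σ) : extd (extd σ) = 0 := by
  funext u
  ext v
  have hu : extChartAt 𝓘(ℝ, H) u u ∈ (extChartAt 𝓘(ℝ, H) u).target := mem_extChartAt_target u
  have hev : formInChart (LiouvilleBundle.extd σ) u =ᶠ[nhds (extChartAt 𝓘(ℝ, H) u u)]
      extDeriv (formInChart σ u) := by
    filter_upwards [(isOpen_extChartAt_target u).mem_nhds hu] with z hz
    exact formInChart_extd hσ u hz
  rw [extd_apply, hev.extDeriv_eq, extDeriv_extDeriv_apply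
    ((hσ u).contDiffAt ((isOpen_extChartAt_target u).mem_nhds hu)) minSmoothness_real_two_le]
  rfl

/-- The trivialization of the tangent bundle at `u` acts on nearby tangent spaces as the derivative
of the chart at `u`, so the trivialized section is the coordinate representative of `Y` read on the
manifold. -/
theorem isSmoothField_iff (Y : VField H N) :
    IsSmoothField Y ↔ ∀ u : N, ContDiffOn ℝ ∞ (fieldInChart Y u) (extChartAt 𝓘(ℝ, H) u).target := by
  have key : ∀ u, ∀ w ∈ (extChartAt 𝓘(ℝ, H) u).source,
      ContMDiffAt 𝓘(ℝ, H) 𝓘(ℝ, H).tangent ∞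
        (fun u : N => (⟨u, Y u⟩ : TangentBundle 𝓘(ℝ, H) N)) w ↔
      ContDiffAt ℝ ∞ (fieldInChart Y u) (extChartAt 𝓘(ℝ, H) u w) := by
    intro u w hw
    have hw' : w ∈ (chartAt H u).source := by rwa [extChartAt_source] at hw
    have hb : w ∈ (trivializationAt H (TangentSpace 𝓘(ℝ, H)) u).baseSet := by
      simpa using hw'
    have ht : extChartAt 𝓘(ℝ, H) u w ∈ (extChartAt 𝓘(ℝ, H) u).target :=
      (extChartAt 𝓘(ℝ, H) u).map_source hw
    rw [(trivializationAt H (TangentSpace 𝓘(ℝ, H)) u).contMDiffAt_section_iff hb]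
    have hev : (fun x => ((trivializationAt H (TangentSpace 𝓘(ℝ, H)) u) ⟨x, Y x⟩).2)
        =ᶠ[nhds w] fun x => (mfderiv 𝓘(ℝ, H) 𝓘(ℝ, H) (extChartAt 𝓘(ℝ, H) u) x (Y x) : H) := by
      filter_upwards [(isOpen_extChartAt_source u).mem_nhds hw] with x hx
      rw [extChartAt_source] at hx
      rw [← TangentBundle.continuousLinearMapAt_trivializationAt hx]
      exact (Trivialization.continuousLinearMapAt_apply_of_mem ℝ _ (by simpa using hx) _).symm
    rw [hev.contMDiffAt_iff]
    constructor
    · intro h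
      rw [← contMDiffAt_iff_contDiffAt]
      have h1 := (contMDiffOn_extChartAt_symm (I := 𝓘(ℝ, H)) (n := ∞) u).contMDiffAt
        ((isOpen_extChartAt_target u).mem_nhds ht)
      rw [← (extChartAt 𝓘(ℝ, H) u).left_inv hw] at h
      exact h.comp _ h1
    · intro h
      rw [← contMDiffAt_iff_contDiffAt] at h
      have h2 : ContMDiffAt 𝓘(ℝ, H) 𝓘(ℝ, H) ∞ (extChartAt 𝓘(ℝ, H) u) w :=
        contMDiffAt_extChartAt' hw'
      refine (h.comp w h2).congr_of_eventuallyEq ?_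
      filter_upwards [(isOpen_extChartAt_source u).mem_nhds hw] with x hx
      simp only [fieldInChart, Function.comp_apply]
      rw [(extChartAt 𝓘(ℝ, H) u).left_inv hx]
  constructor
  · intro h u y hy
    have h1 := (key u _ ((extChartAt 𝓘(ℝ, H) u).map_target hy)).1 (h _)
    rw [(extChartAt 𝓘(ℝ, H) u).right_inv hy] at h1
    exact h1.contDiffWithinAt
  · intro h u
    exact (key u u (mem_extChartAt_source u)).2
      ((h u).contDiffAt ((isOpen_extChartAt_target u).mem_nhds (mem_extChartAt_target u)))

end Charts

/-! ### Exterior derivative of vector-valued 1-forms on a normed space -/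

section Calculus

variable {G H W : Type*} [NormedAddCommGroup G] [NormedSpace ℝ G] [NormedAddCommGroup H]
  [NormedSpace ℝ H] [NormedAddCommGroup W] [NormedSpace ℝ W]

/-- The exterior derivative of a vector-valued `1`-form, as a bilinear map. -/
def curl (a : H → H →L[ℝ] W) (y : H) : H →L[ℝ] H →L[ℝ] W :=
  fderiv ℝ a y - (fderiv ℝ a y).flip

theorem curl_apply (a : H → H →L[ℝ] W) (y v w : H) :
    curl a y v w = fderiv ℝ a y v w - fderiv ℝ a y w v := rfl

theorem curl_sum_smul {ι κ : Type*} [Fintype ι] [Fintype κ] (a : H → H →L[ℝ] W) (y : H)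
    (c : ι → ℝ) (d : κ → ℝ) (v : ι → H) (w : κ → H) :
    curl a y (∑ i, c i • v i) (∑ j, d j • w j) =
      ∑ i, ∑ j, (c i * d j) • curl a y (v i) (w j) := by
  simp only [map_sum, map_smul, sum_apply, smul_apply, Finset.smul_sum, smul_smul]
  rw [Finset.sum_comm]
  simp only [mul_comm]

/-- The product rule produces one extra term, containing the second derivative of `q`; it is
symmetric and cancels under antisymmetrization. -/
theorem curl_pullback {a : G → G →L[ℝ] W} {q : H → G} {y : H}
    (ha : DifferentiableAt ℝ a (q y)) (hq : ContDiffAt ℝ ∞ q y) (v w : H) :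
    curl (fun z => (a (q z)).comp (fderiv ℝ q z)) y v w =
      curl a (q y) (fderiv ℝ q y v) (fderiv ℝ q y w) := by
  have hq' : DifferentiableAt ℝ (fderiv ℝ q) y :=
    (hq.fderiv_right (m := ∞) (by simp)).differentiableAt (by simp)
  have hs : IsSymmSndFDerivAt ℝ q y := hq.isSymmSndFDerivAt minSmoothness_real_two_le
  have h1 : HasFDerivAt (fun z => a (q z)) ((fderiv ℝ a (q y)).comp (fderiv ℝ q y)) y :=
    ha.hasFDerivAt.comp y (hq.differentiableAt (by simp)).hasFDerivAt
  have h2 := h1.clm_comp hq'.hasFDerivAt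
  simp only [curl_apply, h2.fderiv]
  simp [hs.eq v w]

/-- Differentiating the constancy of `a V` and `a W` expresses the bracket of `V` and `W` through
the exterior derivative of `a`. -/
theorem apply_lieBracket_of_eventually_const {a : H → H →L[ℝ] W} {y : H} {V V' : H → H} {c c' : W}
    (ha : DifferentiableAt ℝ a y) (hV : DifferentiableAt ℝ V y) (hV' : DifferentiableAt ℝ V' y)
    (hc : ∀ᶠ z in nhds y, a z (V z) = c) (hc' : ∀ᶠ z in nhds y, a z (V' z) = c') :
    a y (VectorField.lieBracket ℝ V V' y) = -curl a y (V y) (V' y) := by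
  have key : ∀ {U : H → H} {d : W}, DifferentiableAt ℝ U y → (∀ᶠ z in nhds y, a z (U z) = d) →
      ∀ ξ, a y (fderiv ℝ U y ξ) + fderiv ℝ a y ξ (U y) = 0 := by
    intro U d hU hd ξ
    have h1 := ha.hasFDerivAt.clm_apply hU.hasFDerivAt
    have h2 : HasFDerivAt (fun z => a z (U z)) (0 : H →L[ℝ] W) y :=
      (hasFDerivAt_const d y).congr_of_eventuallyEq hd
    have h3 := DFunLike.congr_fun (h1.unique h2) ξ
    simpa using h3
  have k1 := key hV hc (V' y)
  have k2 := key hV' hc' (V y)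
  rw [VectorField.lieBracket, map_sub, eq_neg_of_add_eq_zero_left k1,
    eq_neg_of_add_eq_zero_left k2, curl_apply]
  abel

end Calculus

/-! ### The pulled back coframe in charts and its exterior derivative -/

section Coframe

variable {EM : Type*} [NormedAddCommGroup EM] [NormedSpace ℝ EM]
  {EE : Type*} [NormedAddCommGroup EE] [NormedSpace ℝ EE]
  {M : Type*} [TopologicalSpace M] [ChartedSpace EM M]
  {E : Type*} [TopologicalSpace E] [ChartedSpace EE E]
  {n : ℕ}

/-- The `ℝⁿ`-valued `1`-form `p^* α` in the preferred chart at `u`. -/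
def coframeInChart (p : E → M) (α : (x : M) → TangentSpace 𝓘(ℝ, EM) x →L[ℝ] (Fin n → ℝ)) (u : E)
    (y : EE) : EE →L[ℝ] (Fin n → ℝ) :=
  (α (p ((extChartAt 𝓘(ℝ, EE) u).symm y))).comp
    ((mfderiv 𝓘(ℝ, EE) 𝓘(ℝ, EM) p ((extChartAt 𝓘(ℝ, EE) u).symm y)).comp
      (mfderiv 𝓘(ℝ, EE) 𝓘(ℝ, EE) (extChartAt 𝓘(ℝ, EE) u).symm y))

theorem coframeInChart_apply (p : E → M)
    (α : (x : M) → TangentSpace 𝓘(ℝ, EM) x →L[ℝ] (Fin n → ℝ)) (u : E) (y v : EE) :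
    coframeInChart p α u y v = α (p ((extChartAt 𝓘(ℝ, EE) u).symm y))
      (mfderiv 𝓘(ℝ, EE) 𝓘(ℝ, EM) p ((extChartAt 𝓘(ℝ, EE) u).symm y)
      (mfderiv 𝓘(ℝ, EE) 𝓘(ℝ, EE) (extChartAt 𝓘(ℝ, EE) u).symm y v)) := rfl

/-- The map `p` in the preferred charts at `u` and `p u`. -/
def mapInChart (EM EE : Type*) [NormedAddCommGroup EM] [NormedSpace ℝ EM]
    [NormedAddCommGroup EE] [NormedSpace ℝ EE] [ChartedSpace EM M] [ChartedSpace EE E]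
    (p : E → M) (u : E) (y : EE) : EM :=
  extChartAt 𝓘(ℝ, EM) (p u) (p ((extChartAt 𝓘(ℝ, EE) u).symm y))

theorem mapInChart_self (p : E → M) (u : E) :
    mapInChart EM EE p u (extChartAt 𝓘(ℝ, EE) u u) = extChartAt 𝓘(ℝ, EM) (p u) (p u) := by
  rw [mapInChart, extChartAt_to_inv]

theorem contDiffAt_mapInChart {p : E → M} (hp : ContMDiff 𝓘(ℝ, EE) 𝓘(ℝ, EM) ∞ p) (u : E) :
    ContDiffAt ℝ ∞ (mapInChart EM EE p u) (extChartAt 𝓘(ℝ, EE) u u) := by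
  have h := (contMDiffAt_iff.1 (hp u)).2
  rw [modelWithCornersSelf_coe, range_id] at h
  exact h.contDiffAt Filter.univ_mem

theorem fderiv_mapInChart_self {p : E → M} (hp : ContMDiff 𝓘(ℝ, EE) 𝓘(ℝ, EM) ∞ p) (u : E) :
    fderiv ℝ (mapInChart EM EE p u) (extChartAt 𝓘(ℝ, EE) u u) = tangentProj EM EE p u := by
  unfold tangentProj
  rw [(hp.mdifferentiable (by simp) u).mfderiv, modelWithCornersSelf_coe, range_id,
    fderivWithin_univ]
  rfl

variable [IsManifold 𝓘(ℝ, EE) ∞ E]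

theorem coframeInChart_self (p : E → M)
    (α : (x : M) → TangentSpace 𝓘(ℝ, EM) x →L[ℝ] (Fin n → ℝ)) (u : E)
    (v : TangentSpace 𝓘(ℝ, EE) u) :
    coframeInChart p α u (extChartAt 𝓘(ℝ, EE) u u) v = α (p u) (tangentProj EM EE p u v) := by
  refine (coframeInChart_apply (EE := EE) p α u _ v).trans ?_
  have hv := mfderiv_chart_symm_self (N := E) (H := EE) u v
  rw [hv]
  have : ∀ w : E, w = u → α (p w) (mfderiv 𝓘(ℝ, EE) 𝓘(ℝ, EM) p w (v : EE)) =
    α (p u) (mfderiv 𝓘(ℝ, EE) 𝓘(ℝ, EM) p u v) := by rintro w rfl; rfl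
  exact this _ (extChartAt_to_inv u)

variable [IsManifold 𝓘(ℝ, EM) ∞ M]

/-- On a constant vector `v` this is the smooth function α on `TM` composed with the tangent maps of
`p` and of the inverse chart. In finite dimension, smoothness on each `v` gives smoothness of the
operator-valued map. -/
theorem contDiffOn_coframeInChart [FiniteDimensional ℝ EE] {p : E → M}
    (hp : ContMDiff 𝓘(ℝ, EE) 𝓘(ℝ, EM) ∞ p)
    {α : (x : M) → TangentSpace 𝓘(ℝ, EM) x →L[ℝ] (Fin n → ℝ)} (hα : IsCoframe α) (u : E) :
    ContDiffOn ℝ ∞ (coframeInChart p α u) (extChartAt 𝓘(ℝ, EE) u).target := by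
  rw [contDiffOn_clm_apply]
  intro v
  have ho := isOpen_extChartAt_target (I := 𝓘(ℝ, EE)) u
  have h1 := (contMDiffOn_extChartAt_symm (I := 𝓘(ℝ, EE)) (n := ∞) u).contMDiffOn_tangentMapWithin
    (m := ∞) (by simp) ho.uniqueMDiffOn
  have h2 := (hα.smooth.comp (hp.contMDiff_tangentMap (m := ∞) (by simp))).comp_contMDiffOn h1
  have h3 : ContMDiff 𝓘(ℝ, EE) 𝓘(ℝ, EE).tangent ∞
      (fun y : EE => (⟨y, v⟩ : TangentBundle 𝓘(ℝ, EE) EE)) :=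
    contMDiff_vectorSpace_iff_contDiff.2 contDiff_const
  have h4 := h2.comp (s := (extChartAt 𝓘(ℝ, EE) u).target) h3.contMDiffOn (fun y hy => hy)
  rw [← contMDiffOn_iff_contDiffOn]
  refine h4.congr fun y hy => ?_
  rw [coframeInChart_apply]
  simp only [Function.comp_apply, tangentMapWithin, tangentMap]
  rw [mfderivWithin_of_isOpen ho hy]
  rfl

theorem coframeInChart_id_chart (α : (x : M) → TangentSpace 𝓘(ℝ, EM) x →L[ℝ] (Fin n → ℝ))
    {x x' : M} (hx : x' ∈ (extChartAt 𝓘(ℝ, EM) x).source) (ξ : TangentSpace 𝓘(ℝ, EM) x') :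
    coframeInChart (id : M → M) α x (extChartAt 𝓘(ℝ, EM) x x')
      (mfderiv 𝓘(ℝ, EM) 𝓘(ℝ, EM) (extChartAt 𝓘(ℝ, EM) x) x' ξ) = α x' ξ := by
  obtain ⟨y, hy, rfl⟩ : ∃ y ∈ (extChartAt 𝓘(ℝ, EM) x).target,
      (extChartAt 𝓘(ℝ, EM) x).symm y = x' :=
    ⟨_, (extChartAt 𝓘(ℝ, EM) x).map_source hx, (extChartAt 𝓘(ℝ, EM) x).left_inv hx⟩
  rw [(extChartAt 𝓘(ℝ, EM) x).right_inv hy]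
  refine (coframeInChart_apply (id : M → M) α x y _).trans ?_
  rw [mfderiv_id]
  exact congrArg (α ((extChartAt 𝓘(ℝ, EM) x).symm y)) (mfderiv_symm_mfderiv_chart hy ξ)

theorem eventually_coframeInChart_eq {p : E → M} (hp : ContMDiff 𝓘(ℝ, EE) 𝓘(ℝ, EM) ∞ p)
    (α : (x : M) → TangentSpace 𝓘(ℝ, EM) x →L[ℝ] (Fin n → ℝ)) (u : E) :
    coframeInChart p α u =ᶠ[nhds (extChartAt 𝓘(ℝ, EE) u u)] fun y =>
      (coframeInChart id α (p u) (mapInChart EM EE p u y)).comp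
        (fderiv ℝ (mapInChart EM EE p u) y) := by
  have hu := mem_extChartAt_target (I := 𝓘(ℝ, EE)) u
  have ht := (isOpen_extChartAt_target (I := 𝓘(ℝ, EE)) u).mem_nhds hu
  have hc : ContinuousAt (fun y => p ((extChartAt 𝓘(ℝ, EE) u).symm y)) (extChartAt 𝓘(ℝ, EE) u u) :=
    hp.continuous.continuousAt.comp (continuousAt_extChartAt_symm u)
  have hs : ∀ᶠ y in nhds (extChartAt 𝓘(ℝ, EE) u u),
      p ((extChartAt 𝓘(ℝ, EE) u).symm y) ∈ (extChartAt 𝓘(ℝ, EM) (p u)).source := by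
    refine hc ((isOpen_extChartAt_source (p u)).mem_nhds ?_)
    simp only [extChartAt_to_inv]
    exact mem_extChartAt_source _
  filter_upwards [ht, hs] with y hy hys
  ext1 v
  have hd : (fderiv ℝ (mapInChart EM EE p u) y v : EM) =
      mfderiv 𝓘(ℝ, EM) 𝓘(ℝ, EM) (extChartAt 𝓘(ℝ, EM) (p u)) (p ((extChartAt 𝓘(ℝ, EE) u).symm y))
        (mfderiv 𝓘(ℝ, EE) 𝓘(ℝ, EM) p ((extChartAt 𝓘(ℝ, EE) u).symm y)
          (mfderiv 𝓘(ℝ, EE) 𝓘(ℝ, EE) (extChartAt 𝓘(ℝ, EE) u).symm y v)) := by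
    rw [← mfderiv_eq_fderiv]
    have hpd := hp.mdifferentiable (by simp) ((extChartAt 𝓘(ℝ, EE) u).symm y)
    have h := mfderiv_comp y (MDifferentiableAt.comp _ (mdifferentiableAt_chart hys) hpd)
      (mdifferentiableAt_chart_symm hy)
    rw [mfderiv_comp _ (mdifferentiableAt_chart hys) hpd] at h
    exact DFunLike.congr_fun h v
  rw [coframeInChart_apply]
  refine (coframeInChart_id_chart α hys _).symm.trans ?_
  exact congrArg (coframeInChart (id : M → M) α (p u) (mapInChart EM EE p u y)) hd.symm

/-- The exterior derivative `dα` at `x`, computed in the preferred chart at `x`. -/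
def coframeCurl (α : (x : M) → TangentSpace 𝓘(ℝ, EM) x →L[ℝ] (Fin n → ℝ)) (x : M)
    (ξ η : TangentSpace 𝓘(ℝ, EM) x) : Fin n → ℝ :=
  curl (coframeInChart (id : M → M) α x) (extChartAt 𝓘(ℝ, EM) x x) ξ η

/-- This is d(p^*α) = p^*dα: in charts p^*α is the pullback of α by the local representative of `p`,
so `curl_pullback` applies. -/
theorem curl_coframeInChart [FiniteDimensional ℝ EM] {p : E → M}
    (hp : ContMDiff 𝓘(ℝ, EE) 𝓘(ℝ, EM) ∞ p)
    {α : (x : M) → TangentSpace 𝓘(ℝ, EM) x →L[ℝ] (Fin n → ℝ)} (hα : IsCoframe α) (u : E)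
    (v w : TangentSpace 𝓘(ℝ, EE) u) :
    curl (coframeInChart p α u) (extChartAt 𝓘(ℝ, EE) u u) v w =
      coframeCurl α (p u) (tangentProj EM EE p u v) (tangentProj EM EE p u w) := by
  have h1 : DifferentiableAt ℝ (coframeInChart (id : M → M) α (p u))
      (mapInChart EM EE p u (extChartAt 𝓘(ℝ, EE) u u)) := by
    rw [mapInChart_self]
    exact ((contDiffOn_coframeInChart contMDiff_id hα (p u)).contDiffAt
      ((isOpen_extChartAt_target _).mem_nhds (mem_extChartAt_target _))).differentiableAt (by simp)
  have h2 := curl_pullback h1 (contDiffAt_mapInChart hp u) (v : EE) (w : EE)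
  rw [fderiv_mapInChart_self hp u, mapInChart_self] at h2
  refine Eq.trans ?_ h2
  unfold curl
  rw [(eventually_coframeInChart_eq hp α u).fderiv_eq]

end Coframe

/-! ### Structure equation of the coframe -/

section Torsion

variable {EM : Type*} [NormedAddCommGroup EM] [NormedSpace ℝ EM]
  {M : Type*} [TopologicalSpace M] [ChartedSpace EM M] [IsManifold 𝓘(ℝ, EM) ∞ M]
  {n : ℕ} {α : (x : M) → TangentSpace 𝓘(ℝ, EM) x →L[ℝ] (Fin n → ℝ)}

theorem IsCoframe.isInvertible [FiniteDimensional ℝ EM] (hα : IsCoframe α) (x : M) :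
    (α x).IsInvertible := by
  have : FiniteDimensional ℝ (TangentSpace 𝓘(ℝ, EM) x) := inferInstanceAs (FiniteDimensional ℝ EM)
  have : T2Space (TangentSpace 𝓘(ℝ, EM) x) := inferInstanceAs (T2Space EM)
  have : IsTopologicalAddGroup (TangentSpace 𝓘(ℝ, EM) x) :=
    inferInstanceAs (IsTopologicalAddGroup EM)
  have : ContinuousSMul ℝ (TangentSpace 𝓘(ℝ, EM) x) := inferInstanceAs (ContinuousSMul ℝ EM)
  refine ⟨(LinearEquiv.ofBijective (α x).toLinearMap (hα.bijective x)).toContinuousLinearEquiv, ?_⟩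
  ext v
  rfl

theorem IsCoframe.apply_dualFrame [FiniteDimensional ℝ EM] (hα : IsCoframe α) (j : Fin n) (x : M) :
    α x (dualFrame α j x) = Pi.single j 1 :=
  (hα.isInvertible x).self_apply_inverse _

theorem IsCoframe.eq_sum_dualFrame [FiniteDimensional ℝ EM] (hα : IsCoframe α) (x : M)
    (ξ : TangentSpace 𝓘(ℝ, EM) x) : ξ = ∑ j, α x ξ j • dualFrame α j x := by
  apply (hα.bijective x).1
  rw [map_sum]
  simp_rw [map_smul, hα.apply_dualFrame]
  ext i
  simp [Finset.sum_apply, Pi.single_apply]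

theorem coframeInChart_isInvertible [FiniteDimensional ℝ EM] (hα : IsCoframe α) (x : M) {y : EM}
    (hy : y ∈ (extChartAt 𝓘(ℝ, EM) x).target) :
    (coframeInChart (id : M → M) α x y).IsInvertible := by
  have h1 := isInvertible_mfderivWithin_extChartAt_symm hy
  rw [modelWithCornersSelf_coe, range_id, mfderivWithin_univ] at h1
  unfold coframeInChart
  rw [mfderiv_id]
  exact (hα.isInvertible _).comp h1

/-- In dα(X_j, X_k) = X_j(α(X_k)) - X_k(α(X_j)) - α([X_j, X_k]) the first two terms vanish, because
α is constant on the dual frame. -/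
theorem coframe_mlieBracket [FiniteDimensional ℝ EM] (hα : IsCoframe α) (j k : Fin n) (x : M) :
    α x (VectorField.mlieBracket 𝓘(ℝ, EM) (dualFrame α j) (dualFrame α k) x) =
      -coframeCurl α x (dualFrame α j x) (dualFrame α k x) := by
  set a := coframeInChart (EE := EM) (id : M → M) α x with ha
  set y := extChartAt 𝓘(ℝ, EM) x x with hy
  have hyt : y ∈ (extChartAt 𝓘(ℝ, EM) x).target := mem_extChartAt_target x
  have ht := (isOpen_extChartAt_target (I := 𝓘(ℝ, EM)) x).mem_nhds hyt
  -- The frame in coordinates, written exactly as in the definition of `mlieBracket`, so that `hL`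
  -- below holds by `rfl`.
  let V : Fin n → EM → EM := fun j => VectorField.mpullbackWithin 𝓘(ℝ, EM) 𝓘(ℝ, EM)
    (extChartAt 𝓘(ℝ, EM) x).symm (dualFrame α j) (range 𝓘(ℝ, EM))
  have hV : ∀ j, ∀ z ∈ (extChartAt 𝓘(ℝ, EM) x).target, a z (V j z) = Pi.single j 1 := by
    intro j z hz
    have h1 := isInvertible_mfderivWithin_extChartAt_symm hz
    rw [← hα.apply_dualFrame j ((extChartAt 𝓘(ℝ, EM) x).symm z)]
    refine (coframeInChart_apply (id : M → M) α x z _).trans ?_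
    rw [mfderiv_id]
    refine congrArg (α ((extChartAt 𝓘(ℝ, EM) x).symm z)) ?_
    rw [← mfderivWithin_univ, ← range_id, ← modelWithCornersSelf_coe ℝ EM]
    exact h1.self_apply_inverse _
  have had : ContDiffAt ℝ ∞ a y := (contDiffOn_coframeInChart contMDiff_id hα x).contDiffAt ht
  have hVd : ∀ j, DifferentiableAt ℝ (V j) y := by
    intro j
    -- Smoothness of the frame comes from that of the coframe, since operator inversion is smooth at
    -- invertible operators.
    have h1 : V j =ᶠ[nhds y] fun z => (a z).inverse (Pi.single j 1) := by
      filter_upwards [ht] with z hz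
      rw [← hV j z hz, (coframeInChart_isInvertible hα x hz).inverse_apply_self]
    have h2 : ContDiffAt ℝ ∞ (fun z => (a z).inverse) y :=
      (coframeInChart_isInvertible hα x hyt).contDiffAt_map_inverse.comp y had
    exact ((h2.clm_apply contDiffAt_const).differentiableAt (by simp)).congr_of_eventuallyEq h1
  have hVy : ∀ j, V j y = dualFrame α j x := by
    intro j
    apply (coframeInChart_isInvertible hα x hyt).injective
    refine (hV j y hyt).trans ?_
    rw [← hα.apply_dualFrame j x]
    refine Eq.symm ((coframeInChart_self (EE := EM) (id : M → M) α x _).trans ?_)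
    unfold tangentProj
    rw [mfderiv_id]
    rfl
  have hB : (VectorField.mlieBracket 𝓘(ℝ, EM) (dualFrame α j) (dualFrame α k) x : EM) =
      VectorField.lieBracket ℝ (V j) (V k) y := by
    have hS : (extChartAt 𝓘(ℝ, EM) x).symm ⁻¹' univ ∩ range 𝓘(ℝ, EM) = univ := by simp
    have hL : (VectorField.mlieBracket 𝓘(ℝ, EM) (dualFrame α j) (dualFrame α k) x : EM) =
        (mfderiv 𝓘(ℝ, EM) 𝓘(ℝ, EM) (extChartAt 𝓘(ℝ, EM) x) x).inverse
          (VectorField.lieBracketWithin (E := EM) ℝ (V j) (V k)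
            ((extChartAt 𝓘(ℝ, EM) x).symm ⁻¹' univ ∩ range 𝓘(ℝ, EM)) y) := rfl
    rw [hL, hS, VectorField.lieBracketWithin_univ, mfderiv_extChartAt_self]
    exact DFunLike.congr_fun ContinuousLinearMap.inverse_id _
  have h1 := apply_lieBracket_of_eventually_const (had.differentiableAt (by simp)) (hVd j) (hVd k)
    (Filter.mem_of_superset ht (hV j)) (Filter.mem_of_superset ht (hV k))
  rw [hVy j, hVy k, ← hB] at h1
  refine Eq.trans ?_ h1
  refine Eq.symm ((coframeInChart_self (EE := EM) (id : M → M) α x _).trans ?_)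
  unfold tangentProj
  rw [mfderiv_id]
  rfl

/-- Both arguments are expanded in the dual frame. The sum runs over all ordered pairs (j, k), hence
there is no factor 1/2. -/
theorem coframeCurl_eq_sum_torsion [FiniteDimensional ℝ EM] (hα : IsCoframe α) (x : M)
    (ξ η : TangentSpace 𝓘(ℝ, EM) x) (i : Fin n) :
    coframeCurl α x ξ η i = -∑ j, ∑ k, α x ξ j * α x η k * torsion α i j k x := by
  have h1 : coframeCurl α x ξ η =
      ∑ j, ∑ k, (α x ξ j * α x η k) • coframeCurl α x (dualFrame α j x) (dualFrame α k x) := by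
    have hξ : (ξ : EM) = ∑ j, α x ξ j • (dualFrame α j x : EM) := hα.eq_sum_dualFrame x ξ
    have hη : (η : EM) = ∑ j, α x η j • (dualFrame α j x : EM) := hα.eq_sum_dualFrame x η
    exact (congrArg₂ (fun a b : EM => curl (coframeInChart (id : M → M) α x)
      (extChartAt 𝓘(ℝ, EM) x x) a b) hξ hη).trans (curl_sum_smul _ _ _ _ _ _)
  rw [h1, Finset.sum_apply, ← Finset.sum_neg_distrib]
  refine Finset.sum_congr rfl fun j _ => ?_
  rw [Finset.sum_apply, ← Finset.sum_neg_distrib]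
  refine Finset.sum_congr rfl fun k _ => ?_
  rw [torsion, coframe_mlieBracket hα, Pi.smul_apply, Pi.neg_apply, smul_eq_mul, mul_neg, neg_neg]

end Torsion

/-! ### Musical isomorphism of a 2-form on a vector space -/

section Algebra

variable {H W : Type*} [NormedAddCommGroup H] [NormedSpace ℝ H] [NormedAddCommGroup W]
  [NormedSpace ℝ W]

theorem isInvertible_of_bijective [FiniteDimensional ℝ H] {A : H →L[ℝ] W}
    (hA : Function.Bijective A) : A.IsInvertible := by
  have : FiniteDimensional ℝ W := Module.Finite.of_surjective A.toLinearMap hA.2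
  exact ⟨(LinearEquiv.ofBijective A.toLinearMap hA).toContinuousLinearEquiv, by ext v; rfl⟩

/-- A `1`-form as a continuous linear map, depending linearly on the form. -/
def oneFormEquiv (H : Type*) [NormedAddCommGroup H] [NormedSpace ℝ H] :
    (H →L[ℝ] ℝ) ≃ₗᵢ[ℝ] (H [⋀^Fin 1]→L[ℝ] ℝ) :=
  ContinuousAlternatingMap.ofSubsingletonLIE (0 : Fin 1)

theorem oneFormEquiv_symm_apply (a : H [⋀^Fin 1]→L[ℝ] ℝ) (v : H) :
    (oneFormEquiv H).symm a v = a ![v] := by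
  have : (![v] : Fin 1 → H) = fun _ => v := by ext i; fin_cases i; rfl
  rw [this]
  rfl

theorem oneFormEquiv_apply (a : H →L[ℝ] ℝ) (v : H) : oneFormEquiv H a ![v] = a v := by
  rw [← oneFormEquiv_symm_apply, LinearIsometryEquiv.symm_apply_apply]

/-- The musical map of a `2`-form. -/
def musical (s : H [⋀^Fin 2]→L[ℝ] ℝ) : H →L[ℝ] H →L[ℝ] ℝ :=
  ((oneFormEquiv H).symm.toContinuousLinearEquiv : (H [⋀^Fin 1]→L[ℝ] ℝ) →L[ℝ] (H →L[ℝ] ℝ)).comp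
    s.curryLeft

theorem musical_apply (s : H [⋀^Fin 2]→L[ℝ] ℝ) (v w : H) : musical s v w = s ![v, w] :=
  oneFormEquiv_symm_apply (s.curryLeft v) w

theorem musical_bijective [FiniteDimensional ℝ H] {s : H [⋀^Fin 2]→L[ℝ] ℝ}
    (hs : ∀ v, (∀ w, s ![v, w] = 0) → v = 0) : Function.Bijective (musical s) := by
  have hinj : Function.Injective (musical s).toLinearMap := by
    rw [← LinearMap.ker_eq_bot, LinearMap.ker_eq_bot']
    intro v hv
    refine hs v fun w => ?_
    rw [← musical_apply]
    exact DFunLike.congr_fun hv w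
  have hfr : Module.finrank ℝ H = Module.finrank ℝ (H →L[ℝ] ℝ) := by
    rw [← (LinearMap.toContinuousLinearMap (𝕜 := ℝ) (E := H) (F' := ℝ)).finrank_eq]
    exact Subspace.dual_finrank_eq.symm
  exact ⟨hinj, (LinearMap.injective_iff_surjective_of_finrank_eq_finrank hfr).1 hinj⟩

theorem contDiffOn_musical [FiniteDimensional ℝ H] {s : H → H [⋀^Fin 2]→L[ℝ] ℝ} {t : Set H}
    (hs : ContDiffOn ℝ ∞ s t) : ContDiffOn ℝ ∞ (fun y => musical (s y)) t := by
  rw [contDiffOn_clm_apply]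
  intro v
  rw [contDiffOn_clm_apply]
  intro w
  simp only [musical_apply]
  exact (ContinuousAlternatingMap.apply ℝ H ℝ ![v, w]).contDiff.comp_contDiffOn hs

theorem contDiffOn_inverse_apply [CompleteSpace H] {G : Type*} [NormedAddCommGroup G]
    [NormedSpace ℝ G] {A : G → H →L[ℝ] W} {b : G → W} {t : Set G} (hA : ContDiffOn ℝ ∞ A t)
    (hb : ContDiffOn ℝ ∞ b t) (hi : ∀ y ∈ t, (A y).IsInvertible) :
    ContDiffOn ℝ ∞ (fun y => (A y).inverse (b y)) t := by
  have h : ContDiffOn ℝ ∞ (fun y => (A y).inverse) t := fun y hy =>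
    (hi y hy).contDiffAt_map_inverse.comp_contDiffWithinAt y (hA y hy)
  exact h.clm_apply hb

end Algebra

/-! ### Musical isomorphism on a manifold and Cartan's formula -/

section Forms

variable {H : Type*} [NormedAddCommGroup H] [NormedSpace ℝ H]
  {N : Type*} [TopologicalSpace N] [ChartedSpace H N]

theorem flat_apply (σ : FormField H N 2) (u : N) (v w : TangentSpace 𝓘(ℝ, H) u) :
    flat σ u v w = σ u ![v, w] := by
  have : Function.update ![v, 0] 1 w = ![v, w] := by ext i; fin_cases i <;> rfl
  rw [← this]
  rfl

theorem flat_bijective [FiniteDimensional ℝ H] {σ : FormField H N 2} {u : N}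
    (hσ : ∀ v : TangentSpace 𝓘(ℝ, H) u, (∀ w : TangentSpace 𝓘(ℝ, H) u, σ u ![v, w] = 0) → v = 0) :
    Function.Bijective (flat σ u) := by
  have h : flat σ u = (musical (H := H) (σ u) : H → H →L[ℝ] ℝ) := by
    funext v
    ext w
    exact (flat_apply σ u v w).trans (musical_apply (H := H) (σ u) v w).symm
  rw [h]
  exact musical_bijective (H := H) hσ

theorem flat_sharp [FiniteDimensional ℝ H] {σ : FormField H N 2} (hσ : IsSymplectic σ) (u : N)
    (a : TangentSpace 𝓘(ℝ, H) u →L[ℝ] ℝ) : flat σ u (sharp σ u a) = a :=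
  Function.invFun_eq ((flat_bijective (hσ.nondegenerate u)).2 a)

theorem sharp_flat [FiniteDimensional ℝ H] {σ : FormField H N 2} (hσ : IsSymplectic σ) (u : N)
    (v : TangentSpace 𝓘(ℝ, H) u) : sharp σ u (flat σ u v) = v :=
  Function.leftInverse_invFun (flat_bijective (hσ.nondegenerate u)).1 v

/-- The local representative of a field of covectors in the preferred chart at `u`. -/
def covectorInChart (a : (u : N) → TangentSpace 𝓘(ℝ, H) u →L[ℝ] ℝ) (u : N) (y : H) : H →L[ℝ] ℝ :=
  (a ((extChartAt 𝓘(ℝ, H) u).symm y)).comp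
    (mfderiv 𝓘(ℝ, H) 𝓘(ℝ, H) (extChartAt 𝓘(ℝ, H) u).symm y)

variable [IsManifold 𝓘(ℝ, H) ∞ N]

theorem mfderiv_symm_fieldInChart (Y : VField H N) (u : N) {y : H}
    (hy : y ∈ (extChartAt 𝓘(ℝ, H) u).target) :
    mfderiv 𝓘(ℝ, H) 𝓘(ℝ, H) (extChartAt 𝓘(ℝ, H) u).symm y (fieldInChart (H := H) Y u y) =
      Y ((extChartAt 𝓘(ℝ, H) u).symm y) :=
  mfderiv_symm_mfderiv_chart hy _

theorem formInChart_nondegenerate {σ : FormField H N 2} (hσ : IsSymplectic σ) (u : N) {y : H}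
    (hy : y ∈ (extChartAt 𝓘(ℝ, H) u).target) (v : H)
    (hv : ∀ w, formInChart σ u y ![v, w] = 0) : v = 0 := by
  have h1 := hσ.nondegenerate ((extChartAt 𝓘(ℝ, H) u).symm y)
    (mfderiv 𝓘(ℝ, H) 𝓘(ℝ, H) (extChartAt 𝓘(ℝ, H) u).symm y v) (by
      intro w
      have h2 := hv (mfderiv 𝓘(ℝ, H) 𝓘(ℝ, H) (extChartAt 𝓘(ℝ, H) u)
        ((extChartAt 𝓘(ℝ, H) u).symm y) w)
      rw [formInChart_apply] at h2
      rw [← h2]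
      congr 1
      ext i
      fin_cases i
      · rfl
      · exact (mfderiv_symm_mfderiv_chart hy w).symm)
  rw [← mfderiv_chart_mfderiv_symm hy v, h1]
  exact map_zero _

/-- In a chart the field solves a linear system with smooth invertible coefficients and smooth
right-hand side. Bijectivity of the musical map makes the choice inside `sharp` harmless. -/
theorem isSmoothField_sharp [FiniteDimensional ℝ H] {σ : FormField H N 2} (hσ : IsSymplectic σ)
    {a : (u : N) → TangentSpace 𝓘(ℝ, H) u →L[ℝ] ℝ}
    (ha : ∀ u, ContDiffOn ℝ ∞ (covectorInChart a u) (extChartAt 𝓘(ℝ, H) u).target) :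
    IsSmoothField (fun u => sharp σ u (a u)) := by
  have : CompleteSpace H := FiniteDimensional.complete ℝ H
  rw [isSmoothField_iff]
  intro u
  have hinv : ∀ y ∈ (extChartAt 𝓘(ℝ, H) u).target, (musical (formInChart σ u y)).IsInvertible :=
    fun y hy => isInvertible_of_bijective
      (musical_bijective fun v hv => formInChart_nondegenerate hσ u hy v hv)
  refine (contDiffOn_inverse_apply (contDiffOn_musical (hσ.smooth u)) (ha u) hinv).congr
    fun y hy => ?_
  rw [← (hinv y hy).inverse_apply_self (fieldInChart (fun u => sharp σ u (a u)) u y)]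
  congr 1
  ext w
  rw [musical_apply, formInChart_apply]
  have h2 := DFunLike.congr_fun (flat_sharp hσ _ (a ((extChartAt 𝓘(ℝ, H) u).symm y)))
    (mfderiv 𝓘(ℝ, H) 𝓘(ℝ, H) (extChartAt 𝓘(ℝ, H) u).symm y w)
  rw [flat_apply] at h2
  refine Eq.trans ?_ h2
  congr 1
  ext i
  fin_cases i
  · exact mfderiv_symm_fieldInChart (fun u => sharp σ u (a u)) u hy
  · rfl

/-- Cartan's formula for the Lie derivative of a `1`-form. -/
theorem lieD_eq_extd_add {Θ : FormField H N 1} (hΘ : IsSmoothForm Θ) {Y : VField H N}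
    (hY : IsSmoothField Y) (u : N) (v : TangentSpace 𝓘(ℝ, H) u) :
    lieD Y Θ u ![v] = extd Θ u ![Y u, v] +
      fderiv ℝ (fun y => formInChart Θ u y ![fieldInChart Y u y]) (extChartAt 𝓘(ℝ, H) u u) v := by
  set y := extChartAt 𝓘(ℝ, H) u u with hy
  have hn := (isOpen_extChartAt_target (I := 𝓘(ℝ, H)) u).mem_nhds (mem_extChartAt_target u)
  have hθ : DifferentiableAt ℝ (formInChart Θ u) y :=
    ((hΘ u).contDiffAt hn).differentiableAt (by simp)
  have hη : DifferentiableAt ℝ (fieldInChart Y u) y :=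
    (((isSmoothField_iff Y).1 hY u).contDiffAt hn).differentiableAt (by simp)
  have h1 : HasFDerivAt (fun y => (oneFormEquiv H).symm (formInChart Θ u y)) _ y :=
    (oneFormEquiv H).symm.toContinuousLinearEquiv.hasFDerivAt.comp y hθ.hasFDerivAt
  have h2 := h1.clm_apply hη.hasFDerivAt
  simp only [oneFormEquiv_symm_apply] at h2
  -- Product rule ∂_v(θ(Y)) = (∂_v θ)(Y) + θ(∂_v Y). Its first term cancels the negative term of
  -- dθ(Y, v) in `h5`, leaving the coordinate formula `h4` for the Lie derivative.
  have h3 : fderiv ℝ (fun y => formInChart Θ u y ![fieldInChart Y u y]) y v =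
      fderiv ℝ (formInChart Θ u) y v ![fieldInChart Y u y] +
        formInChart Θ u y ![fderiv ℝ (fieldInChart Y u) y v] := by
    refine (DFunLike.congr_fun h2.fderiv v).trans
      ((add_comm _ _).trans (congrArg₂ (fun a b : ℝ => a + b) ?_ ?_))
    · exact oneFormEquiv_symm_apply (H := H) _ _
    · exact oneFormEquiv_symm_apply (formInChart Θ u y) (fderiv ℝ (fieldInChart Y u) y v)
  have h4 : lieD Y Θ u ![v] = fderiv ℝ (formInChart Θ u) y (fieldInChart Y u y) ![(v : H)] +
      formInChart Θ u y ![fderiv ℝ (fieldInChart Y u) y v] := by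
    have hw : (fun i => (mfderiv 𝓘(ℝ, H) 𝓘(ℝ, H) (extChartAt 𝓘(ℝ, H) u) u (![v] i) : H)) =
        ![(v : H)] := by
      ext i
      fin_cases i
      exact mfderiv_chart_self u v
    have hup : Function.update (fun i => (mfderiv 𝓘(ℝ, H) 𝓘(ℝ, H) (extChartAt 𝓘(ℝ, H) u) u
        (![v] i) : H)) (0 : Fin 1) (fderiv ℝ (fieldInChart Y u) y
          (mfderiv 𝓘(ℝ, H) 𝓘(ℝ, H) (extChartAt 𝓘(ℝ, H) u) u v)) =
        ![fderiv ℝ (fieldInChart Y u) y v] := by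
      ext i
      fin_cases i
      exact congrArg (fderiv ℝ (fieldInChart Y u) y) (mfderiv_chart_self u v)
    simp only [lieD]
    rw [Fin.sum_univ_one]
    exact congrArg₂ (fun a b : ℝ => a + b)
      (congrArg (fderiv ℝ (formInChart Θ u) y (fieldInChart Y u y)) hw)
      (congrArg (formInChart Θ u y) hup)
  have h5 : extd Θ u ![Y u, v] = fderiv ℝ (formInChart Θ u) y (fieldInChart Y u y) ![(v : H)] -
      fderiv ℝ (formInChart Θ u) y v ![fieldInChart Y u y] := by
    rw [fieldInChart_self]
    exact (extd_apply Θ u _).trans (extDeriv_one_apply (H := H) _ _)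
  rw [h3, h4, h5]
  ring

end Forms

/-! ### Exterior and Lie derivatives of Θ_f -/

section Theta

variable {EM : Type*} [NormedAddCommGroup EM] [NormedSpace ℝ EM]
  {EE : Type*} [NormedAddCommGroup EE] [NormedSpace ℝ EE]
  {M : Type*} [TopologicalSpace M] [ChartedSpace EM M]
  {E : Type*} [TopologicalSpace E] [ChartedSpace EE E]
  {n : ℕ}

/-- The differential of a vector-valued function, with values in that vector space. -/
def differential {W : Type*} [NormedAddCommGroup W] [NormedSpace ℝ W] (f : E → W) (u : E) :
    TangentSpace 𝓘(ℝ, EE) u →L[ℝ] W :=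
  mfderiv 𝓘(ℝ, EE) 𝓘(ℝ, W) f u

/-- The value at `u` of the `ℝⁿ`-valued `1`-form `p^* α`. -/
def pullCoframeMap (EE : Type*) [NormedAddCommGroup EE] [NormedSpace ℝ EE] [ChartedSpace EE E]
    (p : E → M) (α : (x : M) → TangentSpace 𝓘(ℝ, EM) x →L[ℝ] (Fin n → ℝ)) (u : E) :
    TangentSpace 𝓘(ℝ, EE) u →L[ℝ] (Fin n → ℝ) :=
  (α (p u)).comp (tangentProj EM EE p u)

theorem dual_apply_eq_sum (φ : StrongDual ℝ (Fin n → ℝ)) (c : Fin n → ℝ) :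
    φ c = ∑ i, c i * φ (Pi.single i 1) := by
  conv_lhs => rw [pi_eq_sum_univ' c]
  simp [map_sum]

theorem thetaForm_apply (p : E → M) (α : (x : M) → TangentSpace 𝓘(ℝ, EM) x →L[ℝ] (Fin n → ℝ))
    (f : E → StrongDual ℝ (Fin n → ℝ)) (u : E) (v : TangentSpace 𝓘(ℝ, EE) u) :
    thetaForm EE p α f u ![v] = f u (pullCoframeMap EE p α u v) := rfl

theorem formInChart_thetaForm (p : E → M)
    (α : (x : M) → TangentSpace 𝓘(ℝ, EM) x →L[ℝ] (Fin n → ℝ))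
    (f : E → StrongDual ℝ (Fin n → ℝ)) (u : E) :
    formInChart (thetaForm EE p α f) u = fun y => oneFormEquiv EE
      ((f ((extChartAt 𝓘(ℝ, EE) u).symm y)).comp (coframeInChart p α u y)) := rfl

theorem fderiv_comp_chart_symm_self {W : Type*} [NormedAddCommGroup W] [NormedSpace ℝ W] {f : E → W}
    (hf : ContMDiff 𝓘(ℝ, EE) 𝓘(ℝ, W) ∞ f) (u : E) (v : TangentSpace 𝓘(ℝ, EE) u) :
    fderiv ℝ (fun y => f ((extChartAt 𝓘(ℝ, EE) u).symm y)) (extChartAt 𝓘(ℝ, EE) u u) v =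
      differential f u v := by
  unfold differential
  rw [(hf.mdifferentiable (by simp) u).mfderiv, modelWithCornersSelf_coe, range_id,
    fderivWithin_univ]
  rfl

variable [IsManifold 𝓘(ℝ, EE) ∞ E]

section

variable {W : Type*} [NormedAddCommGroup W] [NormedSpace ℝ W] {f : E → W}

theorem contDiffOn_comp_chart_symm (hf : ContMDiff 𝓘(ℝ, EE) 𝓘(ℝ, W) ∞ f) (u : E) :
    ContDiffOn ℝ ∞ (fun y => f ((extChartAt 𝓘(ℝ, EE) u).symm y)) (extChartAt 𝓘(ℝ, EE) u).target := by
  rw [← contMDiffOn_iff_contDiffOn]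
  exact hf.comp_contMDiffOn (contMDiffOn_extChartAt_symm u)

theorem fderiv_comp_chart_symm (hf : ContMDiff 𝓘(ℝ, EE) 𝓘(ℝ, W) ∞ f) (u : E) {y : EE}
    (hy : y ∈ (extChartAt 𝓘(ℝ, EE) u).target) :
    fderiv ℝ (fun y => f ((extChartAt 𝓘(ℝ, EE) u).symm y)) y =
      (differential f ((extChartAt 𝓘(ℝ, EE) u).symm y)).comp
        (mfderiv 𝓘(ℝ, EE) 𝓘(ℝ, EE) (extChartAt 𝓘(ℝ, EE) u).symm y) := by
  rw [← mfderiv_eq_fderiv]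
  exact mfderiv_comp y (hf.mdifferentiable (by simp) _) (mdifferentiableAt_chart_symm hy)

end

variable [IsManifold 𝓘(ℝ, EM) ∞ M] {p : E → M}
  {α : (x : M) → TangentSpace 𝓘(ℝ, EM) x →L[ℝ] (Fin n → ℝ)} {f : E → StrongDual ℝ (Fin n → ℝ)}

theorem isSmoothForm_thetaForm [FiniteDimensional ℝ EE] (hp : ContMDiff 𝓘(ℝ, EE) 𝓘(ℝ, EM) ∞ p)
    (hα : IsCoframe α) (hf : ContMDiff 𝓘(ℝ, EE) 𝓘(ℝ, StrongDual ℝ (Fin n → ℝ)) ∞ f) :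
    IsSmoothForm (thetaForm EE p α f) := by
  intro u
  rw [formInChart_thetaForm]
  exact (oneFormEquiv EE).toContinuousLinearEquiv.contDiff.comp_contDiffOn
    ((contDiffOn_comp_chart_symm hf u).clm_comp (contDiffOn_coframeInChart hp hα u))

/-- The product rule d⟨f, p^*α⟩ = ⟨df ∧ p^*α⟩ + ⟨f, p^*dα⟩, computed in the chart at `u`. -/
theorem extd_thetaForm_eq_curl [FiniteDimensional ℝ EE] [FiniteDimensional ℝ EM]
    (hp : ContMDiff 𝓘(ℝ, EE) 𝓘(ℝ, EM) ∞ p)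
    (hα : IsCoframe α) (hf : ContMDiff 𝓘(ℝ, EE) 𝓘(ℝ, StrongDual ℝ (Fin n → ℝ)) ∞ f) (u : E)
    (v w : TangentSpace 𝓘(ℝ, EE) u) :
    extd (thetaForm EE p α f) u ![v, w] =
      differential f u v (pullCoframeMap EE p α u w) -
        differential f u w (pullCoframeMap EE p α u v) +
        f u (coframeCurl α (p u) (tangentProj EM EE p u v) (tangentProj EM EE p u w)) := by
  set y := extChartAt 𝓘(ℝ, EE) u u with hy
  have hn := (isOpen_extChartAt_target (I := 𝓘(ℝ, EE)) u).mem_nhds (mem_extChartAt_target u)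
  have h1 : HasFDerivAt (fun y => f ((extChartAt 𝓘(ℝ, EE) u).symm y)) _ y :=
    (((contDiffOn_comp_chart_symm hf u).contDiffAt hn).differentiableAt (by simp)).hasFDerivAt
  have h2 : HasFDerivAt (coframeInChart p α u) _ y :=
    (((contDiffOn_coframeInChart hp hα u).contDiffAt hn).differentiableAt (by simp)).hasFDerivAt
  have h3 := (oneFormEquiv EE).toContinuousLinearEquiv.hasFDerivAt.comp y (h1.clm_comp h2)
  have h4 : HasFDerivAt (formInChart (thetaForm EE p α f) u) _ y := h3
  have hA : ∀ v : TangentSpace 𝓘(ℝ, EE) u, coframeInChart p α u y v = pullCoframeMap EE p α u v :=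
    coframeInChart_self p α u
  have hfu : f ((extChartAt 𝓘(ℝ, EE) u).symm y) = f u := by rw [hy, extChartAt_to_inv]
  have h5 : ∀ v w : TangentSpace 𝓘(ℝ, EE) u,
      fderiv ℝ (formInChart (thetaForm EE p α f) u) y v ![(w : EE)] =
        f u (fderiv ℝ (coframeInChart p α u) y v w) +
          differential f u v (pullCoframeMap EE p α u w) := by
    intro v w
    rw [h4.fderiv, ← hfu, ← hA w, ← fderiv_comp_chart_symm_self hf u v]
    exact oneFormEquiv_apply (H := EE) _ _
  refine (extd_apply _ u _).trans ((extDeriv_one_apply (H := EE) _ _).trans ?_)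
  rw [h5 v w, h5 w v, ← curl_coframeInChart hp hα u v w]
  have h6 := curl_apply (coframeInChart p α u) y v w
  rw [h6, map_sub (f u)]
  ring

theorem extd_thetaForm [FiniteDimensional ℝ EE] [FiniteDimensional ℝ EM]
    (hp : ContMDiff 𝓘(ℝ, EE) 𝓘(ℝ, EM) ∞ p)
    (hα : IsCoframe α) (hf : ContMDiff 𝓘(ℝ, EE) 𝓘(ℝ, StrongDual ℝ (Fin n → ℝ)) ∞ f) (u : E)
    (v w : TangentSpace 𝓘(ℝ, EE) u) :
    extd (thetaForm EE p α f) u ![v, w] =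
      differential f u v (pullCoframeMap EE p α u w) -
        differential f u w (pullCoframeMap EE p α u v) -
        ∑ i, ∑ j, ∑ k, f u (Pi.single i 1) * torsion α i j k (p u) *
          (pullCoframeMap EE p α u v j * pullCoframeMap EE p α u w k) := by
  rw [extd_thetaForm_eq_curl hp hα hf, sub_eq_add_neg (_ - _), dual_apply_eq_sum (f u),
    ← Finset.sum_neg_distrib]
  congr 1
  refine Finset.sum_congr rfl fun i _ => ?_
  rw [coframeCurl_eq_sum_torsion hα, neg_mul, Finset.sum_mul]
  congr 1
  refine Finset.sum_congr rfl fun j _ => ?_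
  rw [Finset.sum_mul]
  refine Finset.sum_congr rfl fun k _ => ?_
  simp only [pullCoframeMap, ContinuousLinearMap.comp_apply]
  ring

/-- Since p^*α takes the constant value `c` on `Y`, the function Θ(Y) is f evaluated at `c`, and the
exact term in Cartan's formula involves only df. -/
theorem lieD_thetaForm [FiniteDimensional ℝ EE] [FiniteDimensional ℝ EM]
    (hp : ContMDiff 𝓘(ℝ, EE) 𝓘(ℝ, EM) ∞ p)
    (hα : IsCoframe α) (hf : ContMDiff 𝓘(ℝ, EE) 𝓘(ℝ, StrongDual ℝ (Fin n → ℝ)) ∞ f)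
    {Y : VField EE E} (hY : IsSmoothField Y) {c : Fin n → ℝ}
    (hc : ∀ u, pullCoframeMap EE p α u (Y u) = c) (u : E) (v : TangentSpace 𝓘(ℝ, EE) u) :
    lieD Y (thetaForm EE p α f) u ![v] =
      extd (thetaForm EE p α f) u ![Y u, v] + differential f u v c := by
  rw [lieD_eq_extd_add (isSmoothForm_thetaForm hp hα hf) hY]
  congr 1
  have hn := (isOpen_extChartAt_target (I := 𝓘(ℝ, EE)) u).mem_nhds (mem_extChartAt_target u)
  have hev : (fun y => formInChart (thetaForm EE p α f) u y ![fieldInChart Y u y])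
      =ᶠ[nhds (extChartAt 𝓘(ℝ, EE) u u)] fun y => f ((extChartAt 𝓘(ℝ, EE) u).symm y) c := by
    filter_upwards [hn] with y hy
    rw [formInChart_thetaForm, ← hc ((extChartAt 𝓘(ℝ, EE) u).symm y),
      ← mfderiv_symm_fieldInChart Y u hy]
    exact oneFormEquiv_apply (H := EE) _ _
  rw [hev.fderiv_eq, ← fderiv_comp_chart_symm_self hf u v]
  have h1 := ((contDiffOn_comp_chart_symm hf u).contDiffAt hn).differentiableAt (by simp)
  rw [(h1.hasFDerivAt.clm_apply (hasFDerivAt_const c _)).fderiv, ContinuousLinearMap.comp_zero, zero_add]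
  rfl

theorem contDiffOn_pullCoframe [FiniteDimensional ℝ EE] (hp : ContMDiff 𝓘(ℝ, EE) 𝓘(ℝ, EM) ∞ p)
    (hα : IsCoframe α) (j : Fin n) (u : E) :
    ContDiffOn ℝ ∞ (covectorInChart (pullCoframe EE p α j) u) (extChartAt 𝓘(ℝ, EE) u).target :=
  (contDiffOn_const (c := (ContinuousLinearMap.proj j : (Fin n → ℝ) →L[ℝ] ℝ))).clm_comp
    (contDiffOn_coframeInChart hp hα u)

theorem contDiffOn_differential [FiniteDimensional ℝ EE]
    (hf : ContMDiff 𝓘(ℝ, EE) 𝓘(ℝ, StrongDual ℝ (Fin n → ℝ)) ∞ f)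
    (φ : StrongDual ℝ (Fin n → ℝ) →L[ℝ] ℝ) (u : E) :
    ContDiffOn ℝ ∞ (covectorInChart (fun u => φ.comp (differential f u)) u)
      (extChartAt 𝓘(ℝ, EE) u).target := by
  refine ((contDiffOn_const (c := φ)).clm_comp
    ((contDiffOn_comp_chart_symm hf u).fderiv_of_isOpen (m := ∞) (isOpen_extChartAt_target u)
      (by simp))).congr fun y hy => ?_
  rw [fderiv_comp_chart_symm hf u hy]
  rfl

end Theta

/-! ### Linear algebra of the form at one point -/

section LinearAlgebra

variable {T : Type*} [AddCommGroup T] [Module ℝ T] {n : ℕ} {A : T →ₗ[ℝ] (Fin n → ℝ)}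
  {D : T →ₗ[ℝ] StrongDual ℝ (Fin n → ℝ)} {c : Fin n → Fin n → Fin n → ℝ} {s : T → T → ℝ}

/-- A bilinear form `s = D ∧ A` up to terms that involve only `A`. -/
def IsTwistedWedge (A : T →ₗ[ℝ] (Fin n → ℝ)) (D : T →ₗ[ℝ] StrongDual ℝ (Fin n → ℝ))
    (c : Fin n → Fin n → Fin n → ℝ) (s : T → T → ℝ) : Prop :=
  ∀ v w, s v w = D v (A w) - D w (A v) - ∑ i, ∑ j, ∑ k, c i j k * (A v j * A w k)

theorem IsTwistedWedge.of_left (hs : IsTwistedWedge A D c s) {v : T} (hv : A v = 0) (w : T) :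
    s v w = D v (A w) := by
  simp [hs v w, hv]

theorem IsTwistedWedge.of_right (hs : IsTwistedWedge A D c s) (v : T) {w : T} (hw : A w = 0) :
    s v w = -D w (A v) := by
  simp [hs v w, hw]

theorem dual_eq_zero_of_apply {c : Fin n → ℝ} (h : ∀ φ : StrongDual ℝ (Fin n → ℝ), φ c = 0) :
    c = 0 := by
  funext i
  exact h (ContinuousLinearMap.proj i)

/-- Testing `v` against ker A lets D w run through the whole dual, which forces A v = 0. Then s(v,
w) = D v (A w), and surjectivity of A forces D v = 0. -/
theorem IsTwistedWedge.nondegenerate (hs : IsTwistedWedge A D c s) (hA : Function.Surjective A)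
    (hinj : ∀ v, A v = 0 → D v = 0 → v = 0) (hsurj : ∀ φ, ∃ v, A v = 0 ∧ D v = φ) (v : T)
    (hv : ∀ w, s v w = 0) : v = 0 := by
  have h1 : A v = 0 := dual_eq_zero_of_apply fun φ => by
    obtain ⟨w, hw, rfl⟩ := hsurj φ
    have := hv w
    rwa [hs.of_right v hw, neg_eq_zero] at this
  refine hinj v h1 (ContinuousLinearMap.ext fun x => ?_)
  obtain ⟨w, rfl⟩ := hA x
  rw [← hs.of_left h1, hv]
  rfl

theorem IsTwistedWedge.injective_of_nondegenerate (hs : IsTwistedWedge A D c s)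
    (hnd : ∀ v, (∀ w, s v w = 0) → v = 0) (v : T) (hv : A v = 0) (hDv : D v = 0) : v = 0 :=
  hnd v fun w => by rw [hs.of_left hv, hDv]; rfl

theorem IsTwistedWedge.lagrangian (hs : IsTwistedWedge A D c s)
    (hsurj : ∀ φ, ∃ v, A v = 0 ∧ D v = φ) (v : T) :
    A v = 0 ↔ ∀ w, A w = 0 → s v w = 0 := by
  refine ⟨fun hv w hw => by rw [hs.of_left hv, hw, map_zero], fun h => ?_⟩
  refine dual_eq_zero_of_apply fun φ => ?_
  obtain ⟨w, hw, rfl⟩ := hsurj φ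
  rw [← neg_eq_zero, ← hs.of_right v hw, h w hw]

/-- Used to see that the field with i_Y ω = -df_j projects to X_j: on vertical `w` the hypothesis
reads D w (A Y) = D w x, and D w is arbitrary. -/
theorem IsTwistedWedge.map_eq_of_dual (hs : IsTwistedWedge A D c s)
    (hsurj : ∀ φ, ∃ v, A v = 0 ∧ D v = φ) {Y : T} {x : Fin n → ℝ}
    (hY : ∀ w, s Y w = -D w x) : A Y = x := by
  rw [← sub_eq_zero]
  refine dual_eq_zero_of_apply fun φ => ?_
  obtain ⟨w, hw, rfl⟩ := hsurj φ
  have := hY w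
  rw [hs.of_right Y hw, neg_inj] at this
  rw [map_sub, this, sub_self]

/-- With Q(v, w) = ∑ c i j k (A v)_j (A w)_k, the wedge sum with `Y` and `Z` equals D w (A v) - D v
(A w), and the last term is (Q(v, w) - Q(w, v))/2. Antisymmetry of `s` makes Q antisymmetric, so
that term is -Q(w, v); no symmetry of `c` itself is needed. -/
theorem IsTwistedWedge.inverse_formula (hs : IsTwistedWedge A D c s)
    (hanti : ∀ v w, s v w = -s w v) {Y Z : Fin n → T}
    (hY : ∀ j w, s (Y j) w = -D w (Pi.single j 1)) (hZ : ∀ j w, s (Z j) w = A w j) (v w : T) :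
    s w v = ∑ j, (s v (Y j) * s w (Z j) - s v (Z j) * s w (Y j)) +
      (1 / 2 : ℝ) * ∑ i, ∑ j, ∑ k, c i j k *
        (s v (Z j) * s w (Z k) - s v (Z k) * s w (Z j)) := by
  have hY' : ∀ j w, s w (Y j) = D w (Pi.single j 1) := fun j w => by
    rw [hanti, hY, neg_neg]
  have hZ' : ∀ j w, s w (Z j) = -A w j := fun j w => by rw [hanti, hZ]
  simp only [hY', hZ']
  have h1 : ∑ j, (D v (Pi.single j 1) * -A w j - -A v j * D w (Pi.single j 1)) =
      D w (A v) - D v (A w) := by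
    rw [dual_apply_eq_sum (D w), dual_apply_eq_sum (D v), ← Finset.sum_sub_distrib]
    exact Finset.sum_congr rfl fun j _ => by ring
  have h2 : ∑ i, ∑ j, ∑ k, c i j k * (-A v j * -A w k - -A v k * -A w j) =
      ∑ i, ∑ j, ∑ k, c i j k * (A v j * A w k) - ∑ i, ∑ j, ∑ k, c i j k * (A w j * A v k) := by
    simp only [← Finset.sum_sub_distrib]
    exact Finset.sum_congr rfl fun i _ => Finset.sum_congr rfl fun j _ =>
      Finset.sum_congr rfl fun k _ => by ring
  rw [h1, h2]
  have h3 := hs v w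
  have h4 := hs w v
  have h5 := hanti v w
  linarith

end LinearAlgebra

/-! ### Inverse function theorem on a manifold -/

section InverseFunction

variable {EF : Type*} [NormedAddCommGroup EF] [NormedSpace ℝ EF] [FiniteDimensional ℝ EF]
  {W : Type*} [NormedAddCommGroup W] [NormedSpace ℝ W]
  {F : Type*} [TopologicalSpace F] [ChartedSpace EF F] [IsManifold 𝓘(ℝ, EF) ∞ F]

/-- The inverse function theorem for a vector-valued function on a manifold. -/
theorem isLocalDiffeomorphAt_of_bijective {g : F → W} (hg : ContMDiff 𝓘(ℝ, EF) 𝓘(ℝ, W) ∞ g)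
    {y : F} (hy : Function.Bijective (mfderiv 𝓘(ℝ, EF) 𝓘(ℝ, W) g y)) :
    IsLocalDiffeomorphAt 𝓘(ℝ, EF) 𝓘(ℝ, W) ∞ g y := by
  have : CompleteSpace EF := FiniteDimensional.complete ℝ EF
  set φ := chartAt EF y with hφ
  let g' : EF → W := fun z => g (φ.symm z)
  have hg' : ContDiffOn ℝ ∞ g' φ.target := by
    have := contDiffOn_comp_chart_symm hg y
    rwa [extChartAt_target, modelWithCornersSelf_coe_symm, modelWithCornersSelf_coe, range_id,
      preimage_id, inter_univ] at this
  have hyφ : φ y ∈ φ.target := mem_chart_target EF y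
  have hat : ContDiffAt ℝ ∞ g' (φ y) := hg'.contDiffAt (φ.open_target.mem_nhds hyφ)
  have hbij : Function.Bijective (fderiv ℝ g' (φ y)) := by
    have h : (fderiv ℝ g' (φ y) : EF → W) = mfderiv 𝓘(ℝ, EF) 𝓘(ℝ, W) g y :=
      funext fun v => fderiv_comp_chart_symm_self hg y v
    rw [h]
    exact hy
  obtain ⟨A, hA⟩ := isInvertible_of_bijective hbij
  have hA' : HasFDerivAt g' (A : EF →L[ℝ] W) (φ y) := by
    rw [hA]
    exact (hat.differentiableAt (by simp)).hasFDerivAt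
  let Φ := hat.toOpenPartialHomeomorph g' hA' (by simp)
  -- The local inverse must be smooth on its whole domain, not only at the image of `y`. Hence the
  -- restriction to the open set where the derivative is invertible.
  let s : Set EF := φ.target ∩ fderiv ℝ g' ⁻¹' range ((↑) : (EF ≃L[ℝ] W) → EF →L[ℝ] W)
  have hs : IsOpen s := ContinuousOn.isOpen_inter_preimage
    (hg'.continuousOn_fderiv_of_isOpen φ.open_target (by simp)) φ.open_target
    (ContinuousLinearEquiv.isOpen)
  have hys : φ y ∈ s := ⟨hyφ, A, hA⟩
  let Ψ := φ.trans (Φ.restrOpen s hs)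
  have hΨ : ∀ z ∈ Ψ.source, Ψ z = g z := by
    intro z hz
    exact congrArg g (φ.left_inv hz.1)
  have hcs : ContMDiffOn 𝓘(ℝ, EF) 𝓘(ℝ, EF) ∞ φ.symm φ.target := contMDiffOn_chart_symm
  refine ⟨⟨Ψ.toPartialEquiv, Ψ.open_source, Ψ.open_target, hg.contMDiffOn.congr hΨ, ?_⟩, ?_,
    fun z hz => (hΨ z hz).symm⟩
  · intro w hw
    have hw1 : w ∈ Φ.target := hw.1.1
    have hw2 : Φ.symm w ∈ s := hw.1.2
    have hw3 : Φ.symm w ∈ φ.target := hw.2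
    obtain ⟨B, hB⟩ := hw2.2
    have h1 : ContDiffAt ℝ ∞ g' (Φ.symm w) := hg'.contDiffAt (φ.open_target.mem_nhds hw3)
    have h2 : ContDiffAt ℝ ∞ Φ.symm w := by
      refine Φ.contDiffAt_symm hw1 (f₀' := B) ?_ h1
      rw [hB]
      exact (h1.differentiableAt (by simp)).hasFDerivAt
    exact ((hcs.contMDiffAt (φ.open_target.mem_nhds hw3)).comp w
      h2.contMDiffAt).contMDiffWithinAt
  · exact ⟨mem_chart_source EF y, hat.mem_toOpenPartialHomeomorph_source hA' (by simp), hys⟩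

end InverseFunction

/-! ### Tangent spaces of the fibers in a local trivialization -/

section Fiber

variable {EM : Type*} [NormedAddCommGroup EM] [NormedSpace ℝ EM]
  {EF : Type*} [NormedAddCommGroup EF] [NormedSpace ℝ EF]
  {EE : Type*} [NormedAddCommGroup EE] [NormedSpace ℝ EE]
  {M : Type*} [TopologicalSpace M] [ChartedSpace EM M]
  {F : Type*} [TopologicalSpace F] [ChartedSpace EF F]
  {E : Type*} [TopologicalSpace E] [ChartedSpace EE E]
  {p : E → M} {e : Trivialization F p}

/-- The parametrization `F → E_x` given by a local trivialization. -/
def fiberMap (e : Trivialization F p) (x : M) (y : F) : E := e.toOpenPartialHomeomorph.symm (x, y)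

theorem fiberMap_mem_source {x : M} (hx : x ∈ e.baseSet) (y : F) : fiberMap e x y ∈ e.source :=
  e.toOpenPartialHomeomorph.map_target (e.mem_target.2 hx)

theorem trivialization_fiberMap {x : M} (hx : x ∈ e.baseSet) (y : F) :
    e (fiberMap e x y) = (x, y) :=
  e.apply_symm_apply' hx

theorem proj_fiberMap {x : M} (hx : x ∈ e.baseSet) (y : F) : p (fiberMap e x y) = x :=
  e.proj_symm_apply' hx

theorem exists_fiberMap_eq (e : Trivialization F p) {u : E} (hu : p u ∈ e.baseSet) :
    ∃ y, fiberMap e (p u) y = u :=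
  ⟨(e u).2, e.symm_apply_mk_proj (e.mem_source.2 hu)⟩

theorem IsSmoothTrivialization.contMDiff_fiberMap (he : IsSmoothTrivialization EM EF EE e) {x : M}
    (hx : x ∈ e.baseSet) : ContMDiff 𝓘(ℝ, EF) 𝓘(ℝ, EE) ∞ (fiberMap e x) := by
  have h : ContMDiff 𝓘(ℝ, EF) (𝓘(ℝ, EM).prod 𝓘(ℝ, EF)) ∞ (fun y : F => (x, y)) :=
    contMDiff_const.prodMk contMDiff_id
  exact he.contMDiffOn_symm.comp_contMDiff h fun y => e.mem_target.2 hx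

theorem IsSmoothTrivialization.mdifferentiableAt_symm (he : IsSmoothTrivialization EM EF EE e)
    {x : M} (hx : x ∈ e.baseSet) (y : F) :
    MDifferentiableAt (𝓘(ℝ, EM).prod 𝓘(ℝ, EF)) 𝓘(ℝ, EE) e.toOpenPartialHomeomorph.symm (x, y) :=
  (he.contMDiffOn_symm.contMDiffAt (e.open_target.mem_nhds (e.mem_target.2 hx))).mdifferentiableAt
    (by simp)

theorem IsSmoothTrivialization.mdifferentiableAt (he : IsSmoothTrivialization EM EF EE e)
    {u : E} (hu : u ∈ e.source) :
    MDifferentiableAt 𝓘(ℝ, EE) (𝓘(ℝ, EM).prod 𝓘(ℝ, EF)) e u :=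
  (he.contMDiffOn.contMDiffAt (e.open_source.mem_nhds hu)).mdifferentiableAt (by simp)

theorem IsSmoothTrivialization.mdifferentiableAt_snd (he : IsSmoothTrivialization EM EF EE e)
    {u : E} (hu : u ∈ e.source) :
    MDifferentiableAt 𝓘(ℝ, EE) 𝓘(ℝ, EF) (fun u => (e u).2) u :=
  (_root_.mdifferentiableAt_snd (x := e u)).comp u (he.mdifferentiableAt hu)

theorem IsSmoothTrivialization.tangentProj_fiberMap (he : IsSmoothTrivialization EM EF EE e)
    (hp : ContMDiff 𝓘(ℝ, EE) 𝓘(ℝ, EM) ∞ p) {x : M} (hx : x ∈ e.baseSet) (y : F)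
    (η : TangentSpace 𝓘(ℝ, EF) y) :
    tangentProj EM EE p (fiberMap e x y) (mfderiv 𝓘(ℝ, EF) 𝓘(ℝ, EE) (fiberMap e x) y η) = 0 := by
  have h1 := mfderiv_comp y (hp.mdifferentiable (by simp) _)
    ((he.contMDiff_fiberMap hx).mdifferentiable (by simp) y)
  have h2 : p ∘ fiberMap e x = fun _ => x := funext fun y => proj_fiberMap hx y
  rw [h2, mfderiv_const] at h1
  exact (DFunLike.congr_fun h1 η).symm

theorem IsSmoothTrivialization.mfderiv_snd_fiberMap (he : IsSmoothTrivialization EM EF EE e)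
    {x : M} (hx : x ∈ e.baseSet) (y : F) (η : TangentSpace 𝓘(ℝ, EF) y) :
    (mfderiv 𝓘(ℝ, EE) 𝓘(ℝ, EF) (fun u => (e u).2) (fiberMap e x y)
      (mfderiv 𝓘(ℝ, EF) 𝓘(ℝ, EE) (fiberMap e x) y η) : EF) = η := by
  have h1 := mfderiv_comp y (he.mdifferentiableAt_snd (fiberMap_mem_source hx y))
    ((he.contMDiff_fiberMap hx).mdifferentiable (by simp) y)
  have h2 : (fun u => (e u).2) ∘ fiberMap e x = id :=
    funext fun y => by simp [trivialization_fiberMap hx y]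
  rw [h2, mfderiv_id] at h1
  exact (DFunLike.congr_fun h1 η).symm

theorem IsSmoothTrivialization.injective_mfderiv_fiberMap (he : IsSmoothTrivialization EM EF EE e)
    {x : M} (hx : x ∈ e.baseSet) (y : F) :
    Function.Injective (mfderiv 𝓘(ℝ, EF) 𝓘(ℝ, EE) (fiberMap e x) y) :=
  Function.LeftInverse.injective (he.mfderiv_snd_fiberMap hx y)

theorem IsSmoothTrivialization.mfderiv_fiberMap (he : IsSmoothTrivialization EM EF EE e)
    {x : M} (hx : x ∈ e.baseSet) (y : F) (η : EF) :
    (mfderiv 𝓘(ℝ, EF) 𝓘(ℝ, EE) (fiberMap e x) y η : EE) =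
      mfderiv (𝓘(ℝ, EM).prod 𝓘(ℝ, EF)) 𝓘(ℝ, EE) e.toOpenPartialHomeomorph.symm (x, y)
        ((0 : EM), η) := by
  have h1 := mfderiv_comp (f := fun y : F => (x, y)) y (he.mdifferentiableAt_symm hx y)
    (mdifferentiableAt_const.prodMk mdifferentiableAt_id)
  have h3 : mfderiv 𝓘(ℝ, EF) (𝓘(ℝ, EM).prod 𝓘(ℝ, EF)) (fun y : F => (x, y)) y η =
      ((0 : EM), η) := by
    have h4 := mfderiv_prodMk (I := 𝓘(ℝ, EF)) (I' := 𝓘(ℝ, EM)) (I'' := 𝓘(ℝ, EF)) (f := fun _ => x)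
      (x := y) mdifferentiableAt_const mdifferentiableAt_id
    rw [mfderiv_const, mfderiv_id] at h4
    exact DFunLike.congr_fun h4 η
  rw [← h3]
  exact DFunLike.congr_fun h1 η

theorem IsSmoothTrivialization.mfderiv_apply (he : IsSmoothTrivialization EM EF EE e)
    (hp : ContMDiff 𝓘(ℝ, EE) 𝓘(ℝ, EM) ∞ p) {u : E} (hu : u ∈ e.source)
    (v : TangentSpace 𝓘(ℝ, EE) u) :
    mfderiv 𝓘(ℝ, EE) (𝓘(ℝ, EM).prod 𝓘(ℝ, EF)) e u v =
      ((tangentProj EM EE p u v : EM),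
        (mfderiv 𝓘(ℝ, EE) 𝓘(ℝ, EF) (fun u => (e u).2) u v : EF)) := by
  have h1 : e =ᶠ[nhds u] fun w => (p w, (e w).2) := by
    filter_upwards [e.open_source.mem_nhds hu] with w hw
    exact Prod.ext (e.coe_fst hw) rfl
  have h2 := mfderiv_prodMk (hp.mdifferentiable (by simp) u) (he.mdifferentiableAt_snd hu)
  rw [h1.mfderiv_eq]
  exact DFunLike.congr_fun h2 v

/-- The trivialization sends a vertical vector to some (0, η), because its first component is `p`.
Applying the derivative of the inverse returns the vector as the image of η. -/
theorem IsSmoothTrivialization.exists_mfderiv_fiberMap_eq (he : IsSmoothTrivialization EM EF EE e)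
    (hp : ContMDiff 𝓘(ℝ, EE) 𝓘(ℝ, EM) ∞ p) {x : M} (hx : x ∈ e.baseSet) (y : F)
    (v : TangentSpace 𝓘(ℝ, EE) (fiberMap e x y))
    (hv : tangentProj EM EE p (fiberMap e x y) v = 0) :
    ∃ η, mfderiv 𝓘(ℝ, EF) 𝓘(ℝ, EE) (fiberMap e x) y η = v := by
  have hu := fiberMap_mem_source hx y
  refine ⟨mfderiv 𝓘(ℝ, EE) 𝓘(ℝ, EF) (fun u => (e u).2) (fiberMap e x y) v, ?_⟩
  refine (he.mfderiv_fiberMap hx y _).trans ?_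
  have h1 := he.mfderiv_apply hp hu v
  rw [hv] at h1
  have hs := he.mdifferentiableAt_symm hx y
  rw [← trivialization_fiberMap hx y] at hs
  have h2 := mfderiv_comp (fiberMap e x y) hs (he.mdifferentiableAt hu)
  have h3 : e.toOpenPartialHomeomorph.symm ∘ e =ᶠ[nhds (fiberMap e x y)] id := by
    filter_upwards [e.open_source.mem_nhds hu] with w hw
    exact e.toOpenPartialHomeomorph.left_inv hw
  rw [h3.mfderiv_eq, mfderiv_id, trivialization_fiberMap hx y] at h2
  have h4 := DFunLike.congr_fun h2 v
  refine Eq.trans ?_ h4.symm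
  exact congrArg (mfderiv (𝓘(ℝ, EM).prod 𝓘(ℝ, EF)) 𝓘(ℝ, EE)
    e.toOpenPartialHomeomorph.symm (x, y)) h1.symm

/-- The local section x' ↦ e⁻¹(x', y) gives a right inverse of the tangent map. -/
theorem IsSmoothTrivialization.surjective_tangentProj (he : IsSmoothTrivialization EM EF EE e)
    (hp : ContMDiff 𝓘(ℝ, EE) 𝓘(ℝ, EM) ∞ p) {x : M} (hx : x ∈ e.baseSet) (y : F) :
    Function.Surjective (tangentProj EM EE p (fiberMap e x y)) := by
  have hs := he.mdifferentiableAt_symm hx y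
  have hx' : MDifferentiableAt 𝓘(ℝ, EM) (𝓘(ℝ, EM).prod 𝓘(ℝ, EF)) (fun x' : M => (x', y)) x :=
    mdifferentiableAt_id.prodMk mdifferentiableAt_const
  have h1 := mfderiv_comp x (f := e.toOpenPartialHomeomorph.symm ∘ fun x' : M => (x', y))
    (hp.mdifferentiable (by simp) _) (MDifferentiableAt.comp x hs hx')
  have h2 : p ∘ (e.toOpenPartialHomeomorph.symm ∘ fun x' : M => (x', y)) =ᶠ[nhds x] id := by
    filter_upwards [e.open_baseSet.mem_nhds hx] with x' hx'
    exact proj_fiberMap hx' y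
  rw [h2.mfderiv_eq, mfderiv_id] at h1
  intro ξ
  exact ⟨_, (DFunLike.congr_fun h1 ξ).symm⟩

end Fiber

/-! ### Vertical derivative of f and nondegeneracy of ω_f -/

section Main

variable {EM : Type*} [NormedAddCommGroup EM] [NormedSpace ℝ EM]
  {EF : Type*} [NormedAddCommGroup EF] [NormedSpace ℝ EF]
  {EE : Type*} [NormedAddCommGroup EE] [NormedSpace ℝ EE]
  {M : Type*} [TopologicalSpace M] [ChartedSpace EM M]
  {F : Type*} [TopologicalSpace F] [ChartedSpace EF F]
  {E : Type*} [TopologicalSpace E] [ChartedSpace EE E]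
  {n : ℕ} {p : E → M} {e : Trivialization F p}
  {α : (x : M) → TangentSpace 𝓘(ℝ, EM) x →L[ℝ] (Fin n → ℝ)} {f : E → StrongDual ℝ (Fin n → ℝ)}

theorem form_two_swap (σ : FormField EE E 2) (u : E) (v w : TangentSpace 𝓘(ℝ, EE) u) :
    σ u ![v, w] = -σ u ![w, v] := by
  have h : ![w, v] ∘ Equiv.swap (0 : Fin 2) 1 = ![v, w] := by
    ext i
    fin_cases i <;> rfl
  exact (congrArg (σ u) h).symm.trans ((σ u).toAlternatingMap.map_swap ![w, v] (by decide))

/-- The differential of `f` at `u` is injective on vertical vectors. -/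
def VerticallyInjective (p : E → M) (α : (x : M) → TangentSpace 𝓘(ℝ, EM) x →L[ℝ] (Fin n → ℝ))
    (f : E → StrongDual ℝ (Fin n → ℝ)) (u : E) : Prop :=
  ∀ v : TangentSpace 𝓘(ℝ, EE) u, pullCoframeMap EE p α u v = 0 → differential f u v = 0 → v = 0

/-- The differential of `f` at `u` is surjective on vertical vectors. -/
def VerticallySurjective (EE : Type*) [NormedAddCommGroup EE] [NormedSpace ℝ EE]
    [ChartedSpace EE E] (p : E → M) (α : (x : M) → TangentSpace 𝓘(ℝ, EM) x →L[ℝ] (Fin n → ℝ))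
    (f : E → StrongDual ℝ (Fin n → ℝ)) (u : E) : Prop :=
  ∀ φ, ∃ v : TangentSpace 𝓘(ℝ, EE) u, pullCoframeMap EE p α u v = 0 ∧ differential f u v = φ

theorem mfderiv_comp_fiberMap (he : IsSmoothTrivialization EM EF EE e)
    (hf : ContMDiff 𝓘(ℝ, EE) 𝓘(ℝ, StrongDual ℝ (Fin n → ℝ)) ∞ f) {x : M} (hx : x ∈ e.baseSet)
    (y : F) (η : TangentSpace 𝓘(ℝ, EF) y) :
    (mfderiv 𝓘(ℝ, EF) 𝓘(ℝ, StrongDual ℝ (Fin n → ℝ)) (fun y => f (fiberMap e x y)) y η :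
      StrongDual ℝ (Fin n → ℝ)) =
      differential f (fiberMap e x y) (mfderiv 𝓘(ℝ, EF) 𝓘(ℝ, EE) (fiberMap e x) y η) := by
  have h := mfderiv_comp y (hf.mdifferentiable (by simp) _)
    ((he.contMDiff_fiberMap hx).mdifferentiable (by simp) y)
  exact DFunLike.congr_fun h η

variable [IsManifold 𝓘(ℝ, EM) ∞ M]

theorem pullCoframeMap_eq_zero_iff (hα : IsCoframe α) (u : E) (v : TangentSpace 𝓘(ℝ, EE) u) :
    pullCoframeMap EE p α u v = 0 ↔ tangentProj EM EE p u v = 0 :=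
  map_eq_zero_iff (α (p u)) (hα.bijective (p u)).1

/-- This derivative is df after the injection of the tangent space of F onto vertical vectors, so it
is injective; source and target both have dimension n. -/
theorem bijective_mfderiv_comp_fiberMap [FiniteDimensional ℝ EF] (hF : Module.finrank ℝ EF = n)
    (he : IsSmoothTrivialization EM EF EE e) (hp : ContMDiff 𝓘(ℝ, EE) 𝓘(ℝ, EM) ∞ p)
    (hα : IsCoframe α) (hf : ContMDiff 𝓘(ℝ, EE) 𝓘(ℝ, StrongDual ℝ (Fin n → ℝ)) ∞ f) {x : M}
    (hx : x ∈ e.baseSet) (y : F)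
    (h : VerticallyInjective (EE := EE) p α f (fiberMap e x y)) :
    Function.Bijective
      (mfderiv 𝓘(ℝ, EF) 𝓘(ℝ, StrongDual ℝ (Fin n → ℝ)) (fun y => f (fiberMap e x y)) y) := by
  let D : EF →L[ℝ] StrongDual ℝ (Fin n → ℝ) :=
    mfderiv 𝓘(ℝ, EF) 𝓘(ℝ, StrongDual ℝ (Fin n → ℝ)) (fun y => f (fiberMap e x y)) y
  have hinj : Function.Injective D.toLinearMap := by
    rw [← LinearMap.ker_eq_bot, LinearMap.ker_eq_bot']
    intro η hη
    apply he.injective_mfderiv_fiberMap hx y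
    refine Eq.trans (h _ ?_ ?_) (ContinuousLinearMap.map_zero _).symm
    · rw [pullCoframeMap_eq_zero_iff hα]
      exact he.tangentProj_fiberMap hp hx y η
    · rw [← mfderiv_comp_fiberMap he hf hx y η]
      exact hη
  have hfr : Module.finrank ℝ EF = Module.finrank ℝ (StrongDual ℝ (Fin n → ℝ)) := by
    rw [← (LinearMap.toContinuousLinearMap (𝕜 := ℝ) (E := Fin n → ℝ) (F' := ℝ)).finrank_eq, hF]
    exact (Subspace.dual_finrank_eq.trans (by simp)).symm
  exact ⟨hinj, (LinearMap.injective_iff_surjective_of_finrank_eq_finrank hfr).1 hinj⟩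

theorem verticallySurjective_of_surjective (he : IsSmoothTrivialization EM EF EE e)
    (hp : ContMDiff 𝓘(ℝ, EE) 𝓘(ℝ, EM) ∞ p)
    (hα : IsCoframe α) (hf : ContMDiff 𝓘(ℝ, EE) 𝓘(ℝ, StrongDual ℝ (Fin n → ℝ)) ∞ f) {x : M}
    (hx : x ∈ e.baseSet) (y : F)
    (h : Function.Surjective
      (mfderiv 𝓘(ℝ, EF) 𝓘(ℝ, StrongDual ℝ (Fin n → ℝ)) (fun y => f (fiberMap e x y)) y)) :
    VerticallySurjective EE p α f (fiberMap e x y) := by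
  intro φ
  obtain ⟨η, hη⟩ := h φ
  refine ⟨mfderiv 𝓘(ℝ, EF) 𝓘(ℝ, EE) (fiberMap e x) y η, ?_, ?_⟩
  · rw [pullCoframeMap_eq_zero_iff hα]
    exact he.tangentProj_fiberMap hp hx y η
  · exact (mfderiv_comp_fiberMap he hf hx y η).symm.trans hη

theorem verticallyInjective_of_injective (he : IsSmoothTrivialization EM EF EE e)
    (hp : ContMDiff 𝓘(ℝ, EE) 𝓘(ℝ, EM) ∞ p)
    (hα : IsCoframe α) (hf : ContMDiff 𝓘(ℝ, EE) 𝓘(ℝ, StrongDual ℝ (Fin n → ℝ)) ∞ f) {x : M}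
    (hx : x ∈ e.baseSet) (y : F)
    (h : Function.Injective
      (mfderiv 𝓘(ℝ, EF) 𝓘(ℝ, StrongDual ℝ (Fin n → ℝ)) (fun y => f (fiberMap e x y)) y)) :
    VerticallyInjective (EE := EE) p α f (fiberMap e x y) := by
  intro v hv hDv
  rw [pullCoframeMap_eq_zero_iff hα] at hv
  obtain ⟨η, rfl⟩ := he.exists_mfderiv_fiberMap_eq hp hx y v hv
  have h0 : η = 0 := by
    apply h
    exact ((mfderiv_comp_fiberMap he hf hx y η).trans hDv).trans
      (ContinuousLinearMap.map_zero _).symm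
  rw [h0, map_zero]

theorem surjective_pullCoframeMap (hp : IsSmoothFiberBundle EM EF EE F p) (hα : IsCoframe α)
    (u : E) : Function.Surjective (pullCoframeMap EE p α u) := by
  obtain ⟨e, hx, he⟩ := hp.locallyTrivial (p u)
  obtain ⟨y, hy⟩ := exists_fiberMap_eq e hx
  have h := he.surjective_tangentProj hp.contMDiff hx y
  rw [hy] at h
  exact (hα.bijective (p u)).2.comp h

theorem verticallySurjective_of_verticallyInjective [FiniteDimensional ℝ EF]
    (hF : Module.finrank ℝ EF = n) (hp : IsSmoothFiberBundle EM EF EE F p) (hα : IsCoframe α)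
    (hf : ContMDiff 𝓘(ℝ, EE) 𝓘(ℝ, StrongDual ℝ (Fin n → ℝ)) ∞ f) {u : E}
    (h : VerticallyInjective (EE := EE) p α f u) : VerticallySurjective EE p α f u := by
  obtain ⟨e, hx, he⟩ := hp.locallyTrivial (p u)
  obtain ⟨y, hy⟩ := exists_fiberMap_eq e hx
  rw [← hy] at h
  have h1 := verticallySurjective_of_surjective he hp.contMDiff hα hf hx y
    (bijective_mfderiv_comp_fiberMap hF he hp.contMDiff hα hf hx y h).2
  rwa [hy] at h1

/-- The right-hand side mentions no trivialization: one through each point suffices to derive it,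
and it yields the local diffeomorphism property for all of them. -/
theorem isFiberwiseLocalDiffeo_iff [FiniteDimensional ℝ EF] [IsManifold 𝓘(ℝ, EF) ∞ F]
    (hF : Module.finrank ℝ EF = n) (hp : IsSmoothFiberBundle EM EF EE F p) (hα : IsCoframe α)
    (hf : ContMDiff 𝓘(ℝ, EE) 𝓘(ℝ, StrongDual ℝ (Fin n → ℝ)) ∞ f) :
    IsFiberwiseLocalDiffeo EM EF EE F p f ↔ ∀ u, VerticallyInjective (EE := EE) p α f u := by
  constructor
  · intro h u
    obtain ⟨e, hx, he⟩ := hp.locallyTrivial (p u)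
    obtain ⟨y, hy⟩ := exists_fiberMap_eq e hx
    have h1 := (h (p u) e hx he y).mfderivToContinuousLinearEquiv_coe (by simp)
    have h2 := verticallyInjective_of_injective he hp.contMDiff hα hf hx y (by
      have h3 := ((h (p u) e hx he y).mfderivToContinuousLinearEquiv (by simp)).injective
      rw [← ContinuousLinearEquiv.coe_coe, h1] at h3
      exact h3)
    rwa [hy] at h2
  · intro h x e hx he y
    exact isLocalDiffeomorphAt_of_bijective (hf.comp (he.contMDiff_fiberMap hx))
      (bijective_mfderiv_comp_fiberMap hF he hp.contMDiff hα hf hx y (h _))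

variable [IsManifold 𝓘(ℝ, EE) ∞ E] [FiniteDimensional ℝ EM] [FiniteDimensional ℝ EE]

theorem isTwistedWedge_extd_thetaForm (hp : ContMDiff 𝓘(ℝ, EE) 𝓘(ℝ, EM) ∞ p) (hα : IsCoframe α)
    (hf : ContMDiff 𝓘(ℝ, EE) 𝓘(ℝ, StrongDual ℝ (Fin n → ℝ)) ∞ f) (u : E) :
    IsTwistedWedge (T := TangentSpace 𝓘(ℝ, EE) u) (pullCoframeMap EE p α u).toLinearMap
      (differential f u).toLinearMap
      (fun i j k => f u (Pi.single i 1) * torsion α i j k (p u))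
      (fun v w => extd (thetaForm EE p α f) u ![v, w]) :=
  extd_thetaForm hp hα hf u

theorem isSymplectic_extd_thetaForm_iff [FiniteDimensional ℝ EF]
    (hF : Module.finrank ℝ EF = n) (hp : IsSmoothFiberBundle EM EF EE F p) (hα : IsCoframe α)
    (hf : ContMDiff 𝓘(ℝ, EE) 𝓘(ℝ, StrongDual ℝ (Fin n → ℝ)) ∞ f) :
    IsSymplectic (extd (thetaForm EE p α f)) ↔
      ∀ u, VerticallyInjective (EE := EE) p α f u := by
  have hΘ := isSmoothForm_thetaForm hp.contMDiff hα hf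
  constructor
  · intro h u
    exact (isTwistedWedge_extd_thetaForm hp.contMDiff hα hf u).injective_of_nondegenerate
      (h.nondegenerate u)
  · intro h
    exact ⟨hΘ.extd, extd_extd hΘ, fun u =>
      (isTwistedWedge_extd_thetaForm hp.contMDiff hα hf u).nondegenerate
        (surjective_pullCoframeMap hp hα u) (h u)
        (verticallySurjective_of_verticallyInjective hF hp hα hf (h u))⟩

end Main

end LiouvilleBundle

end

/-! ### The theorem -/

theorem proposition1p4 {n : ℕ}
    {EM : Type*} [NormedAddCommGroup EM] [NormedSpace ℝ EM] [FiniteDimensional ℝ EM]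
    {EF : Type*} [NormedAddCommGroup EF] [NormedSpace ℝ EF] [FiniteDimensional ℝ EF]
    {EE : Type*} [NormedAddCommGroup EE] [NormedSpace ℝ EE] [FiniteDimensional ℝ EE]
    {M : Type*} [TopologicalSpace M] [ChartedSpace EM M] [IsManifold 𝓘(ℝ, EM) ∞ M]
    {F : Type*} [TopologicalSpace F] [ChartedSpace EF F] [IsManifold 𝓘(ℝ, EF) ∞ F]
    {E : Type*} [TopologicalSpace E] [ChartedSpace EE E] [IsManifold 𝓘(ℝ, EE) ∞ E]
    (hM : Module.finrank ℝ EM = n) (hF : Module.finrank ℝ EF = n)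
    (p : E → M) (hp : LiouvilleBundle.IsSmoothFiberBundle EM EF EE F p)
    (α : (x : M) → TangentSpace 𝓘(ℝ, EM) x →L[ℝ] (Fin n → ℝ)) (hα : LiouvilleBundle.IsCoframe α)
    (f : E → StrongDual ℝ (Fin n → ℝ))
    (hf : ContMDiff 𝓘(ℝ, EE) 𝓘(ℝ, StrongDual ℝ (Fin n → ℝ)) ∞ f) :
    let Θ : LiouvilleBundle.FormField EE E 1 := LiouvilleBundle.thetaForm EE p α f
    let σ : LiouvilleBundle.FormField EE E 2 := LiouvilleBundle.extd Θ
    let X : Fin n → LiouvilleBundle.VField EM M := LiouvilleBundle.dualFrame α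
    let Z : Fin n → LiouvilleBundle.VField EE E := fun j u =>
      LiouvilleBundle.sharp σ u (LiouvilleBundle.pullCoframe EE p α j u)
    (LiouvilleBundle.IsSymplectic σ ↔ LiouvilleBundle.IsFiberwiseLocalDiffeo EM EF EE F p f) ∧
    (LiouvilleBundle.IsSymplectic σ →
      LiouvilleBundle.IsLiouvilleForm EM p σ Θ ∧
      (∀ j, ∃! Y : LiouvilleBundle.VField EE E, LiouvilleBundle.IsLiouvilleLift p Θ (X j) Y) ∧
      (∀ j, LiouvilleBundle.IsSmoothField (Z j) ∧
        ∀ u, LiouvilleBundle.flat σ u (Z j u) = LiouvilleBundle.pullCoframe EE p α j u) ∧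
      ∀ XΘ : Fin n → LiouvilleBundle.VField EE E,
        (∀ j, LiouvilleBundle.IsLiouvilleLift p Θ (X j) (XΘ j)) →
        ∀ (u : E) (a b : TangentSpace 𝓘(ℝ, EE) u →L[ℝ] ℝ),
          LiouvilleBundle.poissonBivector σ u a b =
            ∑ j, LiouvilleBundle.wedge (XΘ j u) (Z j u) a b +
            (1 / 2 : ℝ) * ∑ i, ∑ j, ∑ k, f u (Pi.single i 1) *
              LiouvilleBundle.torsion α i j k (p u) *
                LiouvilleBundle.wedge (Z j u) (Z k u) a b) := by

  intro Θ σ X Z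
  have hpc := hp.contMDiff
  have hΘ : LiouvilleBundle.IsSmoothForm Θ := LiouvilleBundle.isSmoothForm_thetaForm hpc hα hf
  have hiff : LiouvilleBundle.IsSymplectic σ ↔
      ∀ u, LiouvilleBundle.VerticallyInjective (EE := EE) p α f u :=
    LiouvilleBundle.isSymplectic_extd_thetaForm_iff hF hp hα hf
  refine ⟨hiff.trans (LiouvilleBundle.isFiberwiseLocalDiffeo_iff hF hp hα hf).symm,
    fun hσ => ?_⟩
  have hsurj : ∀ u, LiouvilleBundle.VerticallySurjective EE p α f u := fun u =>
    LiouvilleBundle.verticallySurjective_of_verticallyInjective hF hp hα hf (hiff.1 hσ u)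
  have htw := LiouvilleBundle.isTwistedWedge_extd_thetaForm (EE := EE) hpc hα hf
  have hker := LiouvilleBundle.pullCoframeMap_eq_zero_iff (EE := EE) (p := p) hα
  -- A Liouville lift must satisfy i_Y ω = -df_j: projectability makes p^*α(Y) the constant e_j, so
  -- 0 = L_Y Θ = i_Y ω + df_j. Uniqueness and the bivector formula both use this.
  have hlift : ∀ (j : Fin n) (Y : LiouvilleBundle.VField EE E),
      LiouvilleBundle.IsLiouvilleLift p Θ (X j) Y →
      ∀ u w, σ u ![Y u, w] = -LiouvilleBundle.differential f u w (Pi.single j 1) := by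
    intro j Y hY u w
    have h1 : ∀ u, LiouvilleBundle.pullCoframeMap EE p α u (Y u) = Pi.single j 1 := fun u =>
      (congrArg (α (p u)) (hY.projectable u)).trans (hα.apply_dualFrame j (p u))
    have h2 := LiouvilleBundle.lieD_thetaForm hpc hα hf hY.smooth h1 u w
    exact eq_neg_of_add_eq_zero_left (h2.symm.trans (hY.lie_eq_zero u w))
  refine ⟨⟨hσ, hΘ, ?_, rfl, ?_⟩, ?_, ?_, ?_⟩
  · intro u v hv
    rw [← hker u v] at hv
    refine (LiouvilleBundle.thetaForm_apply p α f u v).trans ?_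
    rw [hv, map_zero]
  · intro u v
    simp only [← hker u]
    exact (htw u).lagrangian (hsurj u) v
  · intro j
    -- Composed with df, this gives the covector field -df_j prescribed by `hlift`.
    let ev : StrongDual ℝ (Fin n → ℝ) →L[ℝ] ℝ :=
      -ContinuousLinearMap.apply ℝ ℝ (Pi.single j 1 : Fin n → ℝ)
    let Y : LiouvilleBundle.VField EE E := fun u =>
      LiouvilleBundle.sharp σ u (ev.comp (LiouvilleBundle.differential f u))
    have hYσ : ∀ u w, σ u ![Y u, w] = -LiouvilleBundle.differential f u w (Pi.single j 1) := by
      intro u w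
      rw [← LiouvilleBundle.flat_apply]
      exact DFunLike.congr_fun (LiouvilleBundle.flat_sharp hσ u _) w
    have hYs : LiouvilleBundle.IsSmoothField Y :=
      LiouvilleBundle.isSmoothField_sharp hσ (LiouvilleBundle.contDiffOn_differential hf ev)
    have hYc : ∀ u, LiouvilleBundle.pullCoframeMap EE p α u (Y u) = Pi.single j 1 := fun u =>
      (htw u).map_eq_of_dual (hsurj u) (hYσ u)
    refine ⟨Y, ⟨hYs, fun u => ?_, fun u v => ?_⟩, fun Y' hY' => ?_⟩
    · apply (hα.bijective (p u)).1
      exact (hYc u).trans (hα.apply_dualFrame j (p u)).symm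
    · refine (LiouvilleBundle.lieD_thetaForm hpc hα hf hYs hYc u v).trans ?_
      exact (congrArg (· + LiouvilleBundle.differential f u v (Pi.single j 1)) (hYσ u v)).trans
        (neg_add_cancel _)
    · funext u
      apply (LiouvilleBundle.flat_bijective (hσ.nondegenerate u)).1
      ext w
      rw [LiouvilleBundle.flat_apply, LiouvilleBundle.flat_apply, hYσ, hlift j Y' hY']
  · exact fun j => ⟨LiouvilleBundle.isSmoothField_sharp hσ
      (LiouvilleBundle.contDiffOn_pullCoframe hpc hα j),
      fun u => LiouvilleBundle.flat_sharp hσ u _⟩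
  · intro XΘ hX u a b
    -- By nondegeneracy a = i_v σ and b = i_w σ, so the left-hand side becomes σ(w, v) and every
    -- pairing on the right becomes a value of σ.
    obtain ⟨v, rfl⟩ := (LiouvilleBundle.flat_bijective (hσ.nondegenerate u)).2 a
    obtain ⟨w, rfl⟩ := (LiouvilleBundle.flat_bijective (hσ.nondegenerate u)).2 b
    simp only [LiouvilleBundle.poissonBivector, LiouvilleBundle.wedge,
      LiouvilleBundle.sharp_flat hσ, LiouvilleBundle.flat_apply]
    refine (htw u).inverse_formula (LiouvilleBundle.form_two_swap σ u)
      (fun j w => hlift j (XΘ j) (hX j) u w) (fun j w => ?_) v w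
    rw [← LiouvilleBundle.flat_apply]
    exact DFunLike.congr_fun (LiouvilleBundle.flat_sharp hσ u _) w
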